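/- **The queueing race.** For each price-move direction $j\in\{-1,+1\}$ let $\kappa^b_j,\mu^b_j,\theta^b_j,\kappa^a_j,\mu^a_j,\theta^a_j>0$ be the order-flow rates at the best bid ($b$) and best ask ($a$) after a price move $j$. Fix $j$, integers $v^b,v^a\ge 1$, $0\le m<v^b$, $l\ge 0$, and write $v=(v^b,v^a)$, $\alpha=(m,l)$. After the price move $j$ the best bid and ask queues contain $v^b$ and $v^a$ unit orders; an agent sells $m$ units by a market order, so that the bid queue contains $v^b-m$ units, and posts a limit order of $l$ units at the end of the ask queue. From then on the following events happen independently at exponential times: on each side $x\in\{a,b\}$, limit orders of one unit arrive with rate $\kappa^x_j$ and join the end of the queue, market orders of one unit arrive with rate $\mu^x_j$ and are executed against the order with the highest time priority, and each outstanding unit order, other than the agent's, is cancelled with rate $\theta^x_j$. The agent does not cancel. The race ends when the bid or the ask queue is empty; its result is $-1$ if the bid queue is depleted first and $+1$ if the ask queue is. For $t\ge0$, $\tilde j\in\{-1,+1\}$, $\tilde z\in\mathbb N$, the reduced semi-Markov kernel $\mathcal Q_{j,v,\alpha}(t,\tilde j,\tilde z)$ is the probability that the race lasts at most $t$, its result is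 $\tilde j$, and $\tilde z$ units of the agent's limit order are executed during it. **The processes.** For a process $L$ let $\tau_L$ be its first passage time to the origin, $F_L(t)=\mathbb P(\tau_L\le t)$, and $f_L\ge 0$ a density of $\tau_L$, i.e. $F_L(t)=\int_0^tf_L(u)\,\mathrm du$ for all $t\ge0$. - $B[v,\kappa,\mu,\theta]$ is the birth-death process on $\mathbb N$ started in $v$, with birth rate $\kappa$ and death rate $\mu+i\theta$ in state $i\ge1$, absorbed in $0$. - $C[v,l,\mu,\theta]$ is the pure death process on $\mathbb N$ started in $l+v$, with death rate $\mu+\max(0,i-l)\theta$ in state $i\ge1$, absorbed in $0$. - $A[v,l,\kappa,\mu,\theta]=(C,G)$ with $C=C[v,l,\mu,\theta]$, and $G$ started in $0$: strictly before $\tau_C$, $G$ is a birth-death process with birth rate $\kappa$ and death rate $i\theta$ in state $i\in\mathbb N$; after $\tau_C$, it has birth rate $\kappa$ and death rate $\mu+i\theta$ in state $i\ge1$, and $0$ is absorbing. Put $B^b=B[v^b-m,\kappa^b_j,\mu^b_j,\theta^b_j]$, $B^a=B[v^a,\kappa^a_j,\mu^a_j,\theta^a_j]$, $A^l=A[v^a,l,\kappa^a_j,\mu^a_j,\theta^a_j]$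 and $C^z=C[v^a,z,\mu^a_j,\theta^a_j]$ for $z\ge1$. **Proposition.** The first passage times of $B^b$, $B^a$, $A^l$ and $C^z$ ($z\ge 1$) have densities. For any choice of the densities, with $f^*_{C^z}(\xi)=e^{\mu^a_j\xi}f_{C^z}(\xi)$ and $f^*_{B^b}(\xi)=e^{-\mu^a_j\xi}f_{B^b}(\xi)$, and for all $t\ge0$, $\tilde j\in\{-1,+1\}$ and $\tilde z\in\mathbb N$, the value $\mathcal Q_{j,v,\alpha}(t,\tilde j,\tilde z)$ is - [S1: $l\ge1$, $\tilde j=+1$] $\ \bigl[F_{A^l}(t)-\int_0^tf_{A^l}(u)F_{B^b}(u)\,\mathrm du\bigr]\mathbf 1_{\{\tilde z=l\}}$; - [S2+: $l=0$, $\tilde j=+1$] $\ \bigl[F_{B^a}(t)-\int_0^tf_{B^a}(u)F_{B^b}(u)\,\mathrm du\bigr]\mathbf 1_{\{\tilde z=0\}}$; - [S2−: $l=0$, $\tilde j=-1$] $\ \bigl[F_{B^b}(t)-\int_0^tf_{B^b}(u)F_{B^a}(u)\,\mathrm du\bigr]\mathbf 1_{\{\tilde z=0\}}$; - [S3: $l\ge1$,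 $\tilde j=-1$, $\tilde z=0$] $\ F_{B^b}(t)-\int_0^tf_{B^b}(u)F_{C^1}(u)\,\mathrm du$; - [S4: $l=1$, $\tilde j=-1$, $\tilde z=1$] $\ \int_0^tf_{B^b}(u)\,[F_{C^1}(u)-F_{A^1}(u)]\,\mathrm du$; - [S5: $l>1$, $\tilde j=-1$, $1\le\tilde z\le l-1$] $\ \int_0^tf^*_{B^b}(\epsilon)\int_0^\epsilon f^*_{C^{\tilde z}}(u)\,\mathrm du\,\mathrm d\epsilon$; - [S6: $l>1$, $\tilde j=-1$, $\tilde z=l$] $\ \int_0^tf_{B^b}(u)\,[F_{C^1}(u)-F_{A^l}(u)]\,\mathrm du-\sum_{z=1}^{l-1}\int_0^tf^*_{B^b}(\epsilon)\int_0^\epsilon f^*_{C^z}(u)\,\mathrm du\,\mathrm d\epsilon$; - $0$ in all other cases ($l\ge1$, $\tilde j=-1$, $\tilde z>l$). -/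

import Mathlib

open MeasureTheory ProbabilityTheory
open scoped NNReal ENNReal

noncomputable section

/-- A continuous-time Markov jump process driven by finitely many kinds of events. When the process
is in state `s`, each event `e` happens, independently of the others, after an exponential time
with rate `rate s e` (never, if the rate is `0`); the first event `e` to happen moves the process
to the state `next s e`, and then everything starts afresh from there. -/
structure JumpSystem (S E : Type) where
  rate : S → E → ℝ≥0
  next : S → E → S

namespace JumpSystem

variable {S E : Type} [MeasurableSpace S] [DiscreteMeasurableSpace S] [Fintype E]

/-- The total rate at which the process leaves (or renews) its state `s`. -/
def totalRate (M : JumpSystem S E) (s : S) : ℝ≥0 := ∑ e, M.rate s e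

/-- The law of the waiting time in state `s` until the first event, which is exponential with the
total rate (the minimum of the exponential event times); it is infinite in an absorbing state. -/
def holdingLaw (M : JumpSystem S E) (s : S) : Measure ℝ≥0∞ :=
  if M.totalRate s = 0 then Measure.dirac ⊤
  else (expMeasure (M.totalRate s)).map ENNReal.ofReal

/-- The law of the state after the first event in state `s`: event `e` is the first one with
probability `rate s e / totalRate s`, independently of the waiting time. -/
def jumpLaw (M : JumpSystem S E) (s : S) : Measure S :=
  if M.totalRate s = 0 then Measure.dirac s
  else ∑ e, (M.rate s e / M.totalRate s) • Measure.dirac (M.next s e)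

instance (M : JumpSystem S E) (s : S) : IsProbabilityMeasure (M.holdingLaw s) := by
  unfold holdingLaw
  split_ifs with h
  · infer_instance
  · have : IsProbabilityMeasure (expMeasure (M.totalRate s)) :=
      isProbabilityMeasure_expMeasure (by exact_mod_cast pos_iff_ne_zero.2 h)
    exact Measure.isProbabilityMeasure_map ENNReal.measurable_ofReal.aemeasurable

instance (M : JumpSystem S E) (s : S) : IsProbabilityMeasure (M.jumpLaw s) := by
  unfold jumpLaw
  split_ifs with h
  · infer_instance
  · constructor
    have h1 : ∑ e, M.rate s e / M.totalRate s = 1 := by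
      rw [← Finset.sum_div]
      exact div_self h
    have h2 : ∑ e, ((M.rate s e / M.totalRate s : ℝ≥0) : ℝ≥0∞) = 1 := by
      exact_mod_cast h1
    rw [Measure.finsetSum_apply, ← h2]
    refine Finset.sum_congr rfl fun e _ => ?_
    rw [Measure.smul_apply, measure_univ, ENNReal.smul_def, smul_eq_mul, mul_one]

/-- One step of the process: from a state to the waiting time in it and the next state. -/
def step (M : JumpSystem S E) : Kernel S (ℝ≥0∞ × S) where
  toFun s := (M.holdingLaw s).prod (M.jumpLaw s)
  measurable' := Measurable.of_discrete

instance (M : JumpSystem S E) : IsMarkovKernel M.step :=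
  ⟨fun s => inferInstanceAs (IsProbabilityMeasure ((M.holdingLaw s).prod (M.jumpLaw s)))⟩

/-- The law of the process started in `s₀`. A path is recorded as a sequence `ω`: `(ω n).2` is the
state after `n` jumps, and `(ω (n + 1)).1` is the time spent in it; `(ω 0).1 = 0`. -/
def pathLaw (M : JumpSystem S E) (s₀ : S) : Measure (ℕ → ℝ≥0∞ × S) :=
  Kernel.trajMeasure (X := fun _ => ℝ≥0∞ × S) (Measure.dirac ((0 : ℝ≥0∞), s₀))
    (fun n => M.step.comap (fun x => (x ⟨n, Finset.mem_Iic.2 le_rfl⟩).2) (by fun_prop))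

/-- The time of the `n`-th jump. -/
def jumpTime (ω : ℕ → ℝ≥0∞ × S) (n : ℕ) : ℝ≥0∞ := ∑ k ∈ Finset.range (n + 1), (ω k).1

/-- The process is in the set of states `D` at time `s`. -/
def IsIn (ω : ℕ → ℝ≥0∞ × S) (s : ℝ≥0) (D : Set S) : Prop :=
  ∃ n, jumpTime ω n ≤ s ∧ s < jumpTime ω (n + 1) ∧ (ω n).2 ∈ D

/-- The first time at which the process is in `D` (infinite if there is none). -/
def passageTime (ω : ℕ → ℝ≥0∞ × S) (D : Set S) : ℝ≥0∞ :=
  ⨅ (s : ℝ≥0) (_ : IsIn ω s D), (s : ℝ≥0∞)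

/-- The cumulative distribution function of the first passage time from `s₀` to `d`. -/
def passageCDF (M : JumpSystem S E) (s₀ d : S) (t : ℝ) : ℝ :=
  (M.pathLaw s₀).real {ω | passageTime ω {d} ≤ ENNReal.ofReal t}

end JumpSystem

/-- `f` is a density of the nonnegative random time with cumulative distribution function `F`. -/
def IsPassageDensity (f F : ℝ → ℝ) : Prop :=
  (∀ u, 0 ≤ f u) ∧
    ∀ t, 0 ≤ t → IntervalIntegrable f volume 0 t ∧ F t = ∫ u in (0 : ℝ)..t, f u

/-! ### Order flow parameters -/

/-- Direction of a price move: down (`-1`) or up (`+1`). -/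
inductive PriceMove where
  | down
  | up

/-- Rates of the order flow of the general market participants at one best price: limit orders
(`κ`), market orders (`μ`), and cancellations per outstanding limit order (`θ`). -/
structure FlowRates where
  κ : ℝ≥0
  μ : ℝ≥0
  θ : ℝ≥0
  κ_pos : 0 < κ
  μ_pos : 0 < μ
  θ_pos : 0 < θ

/-! ### The generalised birth-death processes -/

inductive QueueEvent where
  | birth
  | death

instance : Fintype QueueEvent :=
  ⟨⟨([.birth, .death] : List QueueEvent), by simp⟩, by
    intro x
    cases x <;> simp⟩

/-- The birth-death process `B[v, κ, μ, θ]` (started in `v`): birth rate `κ` and death rate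
`μ + i θ` in state `i ≥ 1`, absorbed in `0`. -/
def birthDeathB (r : FlowRates) : JumpSystem ℕ QueueEvent where
  rate i e := if i = 0 then 0 else
    match e with
    | .birth => r.κ
    | .death => r.μ + i * r.θ
  next i e := match e with
    | .birth => i + 1
    | .death => i - 1

/-- The pure death process `C[v, l, μ, θ]` (started in `l + v`): death rate `μ + max(0, i - l) θ`
in state `i ≥ 1`, absorbed in `0`. The subtraction `i - l` is truncated at `0`. -/
def pureDeathC (l : ℕ) (r : FlowRates) : JumpSystem ℕ Unit where
  rate i _ := if i = 0 then 0 else r.μ + (i - l : ℕ) * r.θ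
  next i _ := i - 1

inductive PairEvent where
  | deathC
  | birthG
  | deathG

instance : Fintype PairEvent :=
  ⟨⟨([.deathC, .birthG, .deathG] : List PairEvent), by simp⟩, by
    intro x
    cases x <;> simp⟩

/-- The process `A[v, l, κ, μ, θ] = (C, G)` (started in `(l + v, 0)`). The component `C` is the
pure death process `C[v, l, μ, θ]`. Strictly before the time at which `C` reaches `0`, `G` is a
birth-death process with birth rate `κ` and death rate `i θ` in state `i`; from that time on, `G`
has birth rate `κ` and death rate `μ + i θ` in state `i ≥ 1`, and `0` is absorbing. -/
def pairA (l : ℕ) (r : FlowRates) : JumpSystem (ℕ × ℕ) PairEvent where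
  rate x e := match e with
    | .deathC => if x.1 = 0 then 0 else r.μ + (x.1 - l : ℕ) * r.θ
    | .birthG => if x.1 = 0 ∧ x.2 = 0 then 0 else r.κ
    | .deathG => if x.1 = 0 then (if x.2 = 0 then 0 else r.μ + x.2 * r.θ) else x.2 * r.θ
  next x e := match e with
    | .deathC => (x.1 - 1, x.2)
    | .birthG => (x.1, x.2 + 1)
    | .deathG => (x.1, x.2 - 1)

/-- The distribution function of the first passage time to the origin of `B[v, κ, μ, θ]`. -/
def cdfB (v : ℕ) (r : FlowRates) : ℝ → ℝ := (birthDeathB r).passageCDF v 0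

/-- The distribution function of the first passage time to the origin of `C[v, l, μ, θ]`. -/
def cdfC (v l : ℕ) (r : FlowRates) : ℝ → ℝ := (pureDeathC l r).passageCDF (l + v) 0

/-- The distribution function of the first passage time to the origin of `A[v, l, κ, μ, θ]`. -/
def cdfA (v l : ℕ) (r : FlowRates) : ℝ → ℝ := (pairA l r).passageCDF (l + v, 0) (0, 0)

/-! ### The queueing race -/

/-- The best queues, in unit orders: the volume at the best bid; and at the best ask, in order of
time priority, the orders ahead of the agent's limit order, the outstanding part of the agent's own
limit order, and the orders behind it. -/
structure Book where
  bid : ℕ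
  ahead : ℕ
  own : ℕ
  behind : ℕ

instance : MeasurableSpace Book := ⊤

instance : DiscreteMeasurableSpace Book := ⟨fun _ => trivial⟩

/-- The total volume at the best ask price. -/
def Book.ask (x : Book) : ℕ := x.ahead + x.own + x.behind

inductive OrderEvent where
  | bidLimit
  | bidMarket
  | bidCancel
  | askLimit
  | askMarket
  | askCancelAhead
  | askCancelBehind

instance : Fintype OrderEvent :=
  ⟨⟨([.bidLimit, .bidMarket, .bidCancel, .askLimit, .askMarket, .askCancelAhead, .askCancelBehind] : List OrderEvent), by simp⟩, by
    intro x
    cases x <;> simp⟩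

/-- The states in which the race is over: one of the two best queues is depleted. -/
def raceOver : Set Book := {x | x.bid = 0 ∨ x.ask = 0}

open Classical in
/-- The order book between two price changes. All events are due to the general market
participants: limit and market orders come at constant rates, and each outstanding limit order of
theirs is cancelled at rate `θ`; the agent does not cancel. At the ask, a new limit order joins the
end of the queue and a market order is executed against the order with the highest time priority. -/
def race (rb ra : FlowRates) : JumpSystem Book OrderEvent where
  rate x e := if x ∈ raceOver then 0 else
    match e with
    | .bidLimit => rb.κ
    | .bidMarket => rb.μ
    | .bidCancel => x.bid * rb.θ
    | .askLimit => ra.κ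
    | .askMarket => ra.μ
    | .askCancelAhead => x.ahead * ra.θ
    | .askCancelBehind => x.behind * ra.θ
  next x e := match e with
    | .bidLimit => { x with bid := x.bid + 1 }
    | .bidMarket => { x with bid := x.bid - 1 }
    | .bidCancel => { x with bid := x.bid - 1 }
    | .askLimit => { x with behind := x.behind + 1 }
    | .askMarket =>
        if 0 < x.ahead then { x with ahead := x.ahead - 1 }
        else if 0 < x.own then { x with own := x.own - 1 }
        else { x with behind := x.behind - 1 }
    | .askCancelAhead => { x with ahead := x.ahead - 1 }
    | .askCancelBehind => { x with behind := x.behind - 1 }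

/-- The states in which the next price move is `j'` (down if the bid queue is depleted, up if the
ask queue is) and `z'` units of the agent's limit order, initially of `l` units, are executed. -/
def raceOutcome (l : ℕ) (j' : PriceMove) (z' : ℕ) : Set Book :=
  {x | l - x.own = z' ∧
    match j' with
    | .down => x.bid = 0
    | .up => x.ask = 0}

/-- The reduced semi-Markov kernel `𝒬_{j, v, α}(t, j', z')` with `v = (vb, va)`, `α = (m, l)`.
After a price move `j`, there are `vb` and `va` unit orders at the best bid and ask; the agent sells
`m` units by a market order at the bid and posts a limit order of `l` units at the ask. The kernel
is the probability that the race that follows lasts at most `t`, that the next price move is `j'`,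
and that `z'` units of the limit order are executed by then. -/
def reducedKernel (bid ask : PriceMove → FlowRates) (j : PriceMove) (vb va m l : ℕ)
    (t : ℝ) (j' : PriceMove) (z' : ℕ) : ℝ :=
  ((race (bid j) (ask j)).pathLaw ⟨vb - m, va, l, 0⟩).real
    {ω | ∃ x : ℝ≥0, JumpSystem.passageTime ω raceOver = x ∧ (x : ℝ) ≤ t ∧
      JumpSystem.IsIn ω x (raceOutcome l j' z')}

end

open Set Filter Topology

namespace JumpSystem

/-! ### Paths with absorbing states -/

section paths

variable {S : Type}

/-! For an absorbing set O, let h(s,t) be the probability that the process started in s is in O at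
time t. Conditioning on the first jump gives an integral equation (`hitProb_eq`), hence continuity
of h and the backward equation ∂h/∂t = Lh with h(·,0) = 1_O, where L is the generator. A maximum
principle, made possible by a Lyapunov function that prevents explosion, shows that bounded
solutions with given initial values are unique (`eq_of_backward`). Formulas for the race are
therefore verified by checking the backward equation, and no coupling of processes is constructed.

The bid volume evolves as B, the ask queue as A (or as B without an agent's order), and the orders
up to the agent's z-th unit as C^z. The passage probabilities of these images thus solve the
backward equation of the race itself until it is over. An order changes only one side of the book,
so L acts as a derivation on a product of a function of the bid and a function of the ask. If F and
W are such solutions and f = ∂F/∂t, then ∂(fW)/∂t = L(fW), and integration in time shows that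
F(0)W(0) + ∫ fW is again a solution (`hitProb_eq_integral_mul`).

It remains to write each outcome as such a product at time 0. With bid depletion as F, the factor W
is 1 - F_{C^1} if no unit is executed, F_{C^z} - F_{C^{z+1}} for 1 ≤ z < l, and F_{C^l} - F_{A^l}
for z = l. With ask depletion as F, the factor is 1 - F_{B^b}. The exponential weights arise because
C^{z+1} needs, after the passage time of C^z, one more independent waiting time of rate μ
(`hitProb_pureDeathC_sub_succ`). In the case z = l > 1 a telescoping sum replaces C^l by C^1. An
arbitrary density agrees almost everywhere with the derivative of its distribution function, so its
choice is immaterial. -/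

lemma jumpTime_succ (ω : ℕ → ℝ≥0∞ × S) (n : ℕ) :
    jumpTime ω (n + 1) = jumpTime ω n + (ω (n + 1)).1 :=
  Finset.sum_range_succ _ _

/-- Once an absorbing state is reached, the process stays in it, and the path is never in any
other absorbing state. -/
lemma eq_of_isIn_absorbing {D : Set S} {ω : ℕ → ℝ≥0∞ × S}
    (hω : ∀ n, (ω n).2 ∈ D → (ω (n + 1)).1 = ⊤) {m n : ℕ} (hm : (ω m).2 ∈ D) (hn : (ω n).2 ∈ D)
    (hm' : jumpTime ω m ≠ ⊤) (hn' : jumpTime ω n ≠ ⊤) : m = n := by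
  have key {m n : ℕ} (h : m < n) (hm : (ω m).2 ∈ D) : jumpTime ω n = ⊤ := by
    have h1 : (ω (m + 1)).1 ≤ jumpTime ω n :=
      Finset.single_le_sum (f := fun k => (ω k).1) (fun _ _ => zero_le) (by simp; omega)
    rwa [hω m hm, top_le_iff] at h1
  rcases lt_trichotomy m n with h | h | h
  · exact absurd (key h hm) hn'
  · exact h
  · exact absurd (key h hn) hm'

lemma passageTime_eq_jumpTime {D : Set S} {ω : ℕ → ℝ≥0∞ × S}
    (hω : ∀ n, (ω n).2 ∈ D → (ω (n + 1)).1 = ⊤) {n : ℕ} (hn : (ω n).2 ∈ D)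
    (hn' : jumpTime ω n ≠ ⊤) : passageTime ω D = jumpTime ω n := by
  refine le_antisymm ?_ (le_iInf₂ fun x ⟨m, h1, h2, h3⟩ => ?_)
  · refine (iInf₂_le (jumpTime ω n).toNNReal ⟨n, ?_, ?_, hn⟩).trans ?_
    all_goals rw [ENNReal.coe_toNNReal hn']
    -- The waiting time in an absorbing state is infinite, so the interval of the `n`-th state has
    -- no right end.
    rw [jumpTime_succ, hω n hn, add_top]
    exact hn'.lt_top
  · rwa [eq_of_isIn_absorbing hω hn h3 hn' (h1.trans_lt ENNReal.coe_lt_top).ne]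

/-- The race for an absorbing set: it lasts at most `t` and ends in `O ⊆ D`. -/
lemma exists_passageTime_iff {D O : Set S} (hOD : O ⊆ D) {ω : ℕ → ℝ≥0∞ × S}
    (hω : ∀ n, (ω n).2 ∈ D → (ω (n + 1)).1 = ⊤) {t : ℝ} (ht : 0 ≤ t) :
    (∃ x : ℝ≥0, passageTime ω D = x ∧ (x : ℝ) ≤ t ∧ IsIn ω x O) ↔
      ∃ n, jumpTime ω n ≤ ENNReal.ofReal t ∧ (ω n).2 ∈ O := by
  constructor
  · rintro ⟨x, -, hxt, n, h1, -, h3⟩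
    refine ⟨n, h1.trans ?_, h3⟩
    rw [← ENNReal.ofReal_coe_nnreal]
    exact ENNReal.ofReal_le_ofReal hxt
  · rintro ⟨n, h1, h2⟩
    have hn' := (h1.trans_lt ENNReal.ofReal_lt_top).ne
    have hx : ((jumpTime ω n).toNNReal : ℝ≥0∞) = jumpTime ω n := ENNReal.coe_toNNReal hn'
    refine ⟨(jumpTime ω n).toNNReal, ?_, ?_, n, hx.ge, ?_, h2⟩
    · rw [hx, passageTime_eq_jumpTime hω (hOD h2) hn']
    · exact ENNReal.toReal_le_of_le_ofReal ht h1
    · rw [jumpTime_succ, hω n (hOD h2), add_top]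
      exact ENNReal.coe_lt_top

lemma passageTime_le_iff {D : Set S} {ω : ℕ → ℝ≥0∞ × S}
    (hω : ∀ n, (ω n).2 ∈ D → (ω (n + 1)).1 = ⊤) (t : ℝ) :
    passageTime ω D ≤ ENNReal.ofReal t ↔
      ∃ n, jumpTime ω n ≤ ENNReal.ofReal t ∧ (ω n).2 ∈ D := by
  constructor
  · intro h
    obtain ⟨x, hx⟩ : ∃ x, IsIn ω x D := by
      by_contra! hne
      simp [passageTime, hne] at h
    obtain ⟨n, h1, -, h3⟩ := hx
    have hn' := (h1.trans_lt ENNReal.coe_lt_top).ne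
    exact ⟨n, by rwa [← passageTime_eq_jumpTime hω h3 hn'], h3⟩
  · rintro ⟨n, h1, h2⟩
    rwa [passageTime_eq_jumpTime hω h2 (h1.trans_lt ENNReal.ofReal_lt_top).ne]

end paths

variable {S E : Type} [MeasurableSpace S] [DiscreteMeasurableSpace S] [Fintype E]

/-! ### Path laws -/

@[fun_prop]
lemma measurable_jumpTime {S : Type} [MeasurableSpace S] (n : ℕ) :
    Measurable fun ω : ℕ → ℝ≥0∞ × S => jumpTime ω n := by
  unfold jumpTime
  fun_prop

instance (M : JumpSystem S E) (s₀ : S) : IsProbabilityMeasure (M.pathLaw s₀) := by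
  unfold pathLaw
  infer_instance

lemma pathLaw_map_zero (M : JumpSystem S E) (s₀ : S) :
    (M.pathLaw s₀).map (fun ω => ω 0) = Measure.dirac (0, s₀) := by
  have h : (fun ω : ℕ → ℝ≥0∞ × S => ω 0) =
      (fun x : Finset.Iic 0 → ℝ≥0∞ × S => x ⟨0, Finset.mem_Iic.2 le_rfl⟩) ∘
        Preorder.frestrictLe 0 := rfl
  rw [h, ← Measure.map_map (by fun_prop) (by fun_prop), pathLaw, Kernel.trajMeasure,
    Measure.map_comp _ _ (by fun_prop), Kernel.traj_map_frestrictLe, Kernel.partialTraj_self,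
    Measure.id_comp, Measure.map_map (by fun_prop) (by fun_prop)]
  exact Measure.map_id

lemma lintegral_pathLaw_zero (M : JumpSystem S E) (s₀ : S) {f : ℝ≥0∞ × S → ℝ≥0∞}
    (hf : Measurable f) : ∫⁻ ω, f (ω 0) ∂M.pathLaw s₀ = f (0, s₀) := by
  rw [← lintegral_map hf (by fun_prop), pathLaw_map_zero, lintegral_dirac' _ hf]

/-- The Markov property in the only form needed: the transition kernel sees just the last state, and
of the rest of the past only the elapsed time is retained. -/
lemma lintegral_pathLaw_succ (M : JumpSystem S E) (s₀ : S) (n : ℕ)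
    {f : (ℝ≥0∞ × S) × (ℝ≥0∞ × S) → ℝ≥0∞} (hf : Measurable f) :
    ∫⁻ ω, f ((jumpTime ω n, (ω n).2), ω (n + 1)) ∂M.pathLaw s₀ =
      ∫⁻ ω, ∫⁻ y, f ((jumpTime ω n, (ω n).2), y) ∂M.step (ω n).2 ∂M.pathLaw s₀ := by
  have key := Kernel.map_frestrictLe_trajMeasure_compProd_eq_map_trajMeasure
    (X := fun _ => ℝ≥0∞ × S) (μ₀ := Measure.dirac ((0 : ℝ≥0∞), s₀))
    (κ := fun n => M.step.comap (fun x => (x ⟨n, Finset.mem_Iic.2 le_rfl⟩).2) (by fun_prop))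
    (a := n)
  -- The clock and state as a function of the first `n + 1` coordinates alone, since the
  -- disintegration of the path law concerns this finite restriction.
  let J : (Finset.Iic n → ℝ≥0∞ × S) → ℝ≥0∞ × S := fun x =>
    (∑ k ∈ Finset.attach (Finset.range (n + 1)),
      (x ⟨k, Finset.mem_Iic.2 (Nat.lt_succ_iff.1 (Finset.mem_range.1 k.2))⟩).1,
      (x ⟨n, Finset.mem_Iic.2 le_rfl⟩).2)
  have hJ : Measurable J := by fun_prop
  have hJω (ω : ℕ → ℝ≥0∞ × S) :
      J (Preorder.frestrictLe n ω) = (jumpTime ω n, (ω n).2) := by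
    simp only [J, jumpTime, Prod.mk.injEq, Preorder.frestrictLe_apply, and_true]
    exact Finset.sum_attach (Finset.range (n + 1)) (fun k => (ω k).1)
  have h := congrArg (fun μ => ∫⁻ p, f (J p.1, p.2) ∂μ) key
  have hF : Measurable fun p : (Finset.Iic n → ℝ≥0∞ × S) × (ℝ≥0∞ × S) => f (J p.1, p.2) := by
    fun_prop
  rw [lintegral_map hF (by fun_prop), Measure.lintegral_compProd hF, lintegral_map] at h
  · simp only [hJω] at h
    exact h.symm
  · exact hF.lintegral_kernel_prod_right'
  · fun_prop

/-! ### Hitting probabilities -/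

/-- The indicator, as a function of the time and the state after `k` more jumps, integrated over
these jumps: the probability, from state `x.2` at time `x.1`, that after `k` more jumps the state
is in `O` and the time at most `t`. -/
noncomputable def hitWeight (M : JumpSystem S E) (O : Set S) (t : ℝ≥0∞) : ℕ → ℝ≥0∞ × S → ℝ≥0∞
  | 0 => {x : ℝ≥0∞ × S | x.1 ≤ t ∧ x.2 ∈ O}.indicator 1
  | k + 1 => fun x => ∫⁻ y, M.hitWeight O t k (x.1 + y.1, y.2) ∂M.step x.2

lemma measurable_hitWeight [Countable S] (M : JumpSystem S E) (O : Set S) (t : ℝ≥0∞) (k : ℕ) :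
    Measurable (M.hitWeight O t k) := by
  induction k with
  | zero => exact measurable_one.indicator ((measurableSet_Iic.preimage measurable_fst).inter
      ((MeasurableSet.of_discrete (s := O)).preimage measurable_snd))
  | succ k ih =>
    have : Measurable fun p : (ℝ≥0∞ × S) × (ℝ≥0∞ × S) => M.hitWeight O t k (p.1.1 + p.2.1, p.2.2) :=
      ih.comp (by fun_prop)
    exact Measurable.lintegral_kernel_prod_right'
      (κ := M.step.comap (Prod.snd : ℝ≥0∞ × S → S) measurable_snd) this

/-- Integrating out one jump at a time keeps the expectation constant, so a statement about the
whole path reduces to the recursively defined weight at the starting point. -/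
lemma lintegral_hitWeight [Countable S] (M : JumpSystem S E) (O : Set S) (t : ℝ≥0∞) (s₀ : S)
    (n k : ℕ) : ∫⁻ ω, M.hitWeight O t k (jumpTime ω n, (ω n).2) ∂M.pathLaw s₀ =
      M.hitWeight O t (n + k) (0, s₀) := by
  induction n generalizing k with
  | zero =>
    simpa [jumpTime] using M.lintegral_pathLaw_zero s₀ (M.measurable_hitWeight O t k)
  | succ n ih =>
    have h := M.lintegral_pathLaw_succ s₀ n
      (f := fun p => M.hitWeight O t k (p.1.1 + p.2.1, p.2.2))
      ((M.measurable_hitWeight O t k).comp (by fun_prop))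
    simp only [← jumpTime_succ] at h
    rw [h, show n + 1 + k = n + (k + 1) by ring, ← ih]
    rfl

/-- Time homogeneity: only the remaining time matters. It turns the clock after the first jump into
a shortened horizon. -/
lemma hitWeight_add (M : JumpSystem S E) (O : Set S) (t r : ℝ≥0∞) (hr : r ≠ ⊤) (k : ℕ)
    (j : ℝ≥0∞) (s : S) : M.hitWeight O (r + t) k (r + j, s) = M.hitWeight O t k (j, s) := by
  induction k generalizing j s with
  | zero =>
    classical
    simp only [hitWeight, indicator_apply]
    exact if_congr (and_congr_left' (ENNReal.add_le_add_iff_left hr)) rfl rfl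
  | succ k ih => simp only [hitWeight, add_assoc, ih]

lemma hitWeight_of_lt (M : JumpSystem S E) (O : Set S) {t j : ℝ≥0∞} (h : t < j) (k : ℕ)
    (s : S) : M.hitWeight O t k (j, s) = 0 := by
  induction k generalizing j s with
  | zero => simp [hitWeight, indicator, h]
  | succ k ih =>
    simp only [hitWeight]
    simp [fun y : ℝ≥0∞ × S => ih (h.trans_le (le_add_right le_rfl) : t < j + y.1) y.2]

/-- The states in `O` are absorbing: the process never leaves them. -/
def Absorbing (M : JumpSystem S E) (O : Set S) : Prop := ∀ s ∈ O, M.totalRate s = 0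

/-- The probability that the process started in `s` is in the absorbing set `O` at time `t`. -/
noncomputable def hitProb (M : JumpSystem S E) (O : Set S) (s : S) (t : ℝ) : ℝ :=
  (M.pathLaw s).real {ω | ∃ n, jumpTime ω n ≤ ENNReal.ofReal t ∧ (ω n).2 ∈ O}

/-- The holding law in a state of total rate zero is the Dirac mass at infinity. This supplies,
almost surely, the pathwise hypothesis of the lemmas on absorbing states. -/
lemma ae_absorbing [Countable S] (M : JumpSystem S E) (s₀ : S) :
    ∀ᵐ ω ∂M.pathLaw s₀, ∀ n, M.totalRate (ω n).2 = 0 → (ω (n + 1)).1 = ⊤ := by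
  refine ae_all_iff.2 fun n => ?_
  let B : Set ((ℝ≥0∞ × S) × (ℝ≥0∞ × S)) := {p | M.totalRate p.1.2 = 0 ∧ p.2.1 ≠ ⊤}
  have hB : MeasurableSet B :=
    ((MeasurableSet.of_discrete (s := {s | M.totalRate s = 0})).preimage
      (by fun_prop : Measurable fun p : (ℝ≥0∞ × S) × (ℝ≥0∞ × S) => p.1.2)).inter
      ((measurableSet_singleton _).compl.preimage
      (by fun_prop : Measurable fun p : (ℝ≥0∞ × S) × (ℝ≥0∞ × S) => p.2.1))
  have h := M.lintegral_pathLaw_succ s₀ n (f := B.indicator 1) (measurable_one.indicator hB)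
  have h0 (ω : ℕ → ℝ≥0∞ × S) :
      ∫⁻ y, B.indicator 1 ((jumpTime ω n, (ω n).2), y) ∂M.step (ω n).2 = 0 := by
    by_cases hs : M.totalRate (ω n).2 = 0
    · change ∫⁻ y, B.indicator 1 ((jumpTime ω n, (ω n).2), y)
        ∂(M.holdingLaw (ω n).2).prod (M.jumpLaw (ω n).2) = 0
      have hm : Measurable fun y =>
          B.indicator (1 : (ℝ≥0∞ × S) × (ℝ≥0∞ × S) → ℝ≥0∞) ((jumpTime ω n, (ω n).2), y) :=
        (measurable_one.indicator hB).comp (by fun_prop)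
      rw [lintegral_prod _ hm.aemeasurable, holdingLaw, if_pos hs, lintegral_dirac]
      simp [B]
    · simp [B, hs]
  simp only [h0, lintegral_zero] at h
  have hm : Measurable fun ω : ℕ → ℝ≥0∞ × S =>
      B.indicator (1 : (ℝ≥0∞ × S) × (ℝ≥0∞ × S) → ℝ≥0∞) ((jumpTime ω n, (ω n).2), ω (n + 1)) :=
    (measurable_one.indicator hB).comp (by fun_prop)
  rw [lintegral_eq_zero_iff hm] at h
  filter_upwards [h] with ω hω hs
  by_contra hne
  have : ((jumpTime ω n, (ω n).2), ω (n + 1)) ∈ B := ⟨hs, hne⟩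
  simp [this] at hω

/-- After an absorbing state has been entered, all later jump times are infinite; hence the events
for different jump numbers are almost surely disjoint and their probabilities add up. -/
lemma measure_hit_eq_tsum [Countable S] (M : JumpSystem S E) {O : Set S} (hO : M.Absorbing O)
    (s : S) (t : ℝ) :
    M.pathLaw s {ω | ∃ n, jumpTime ω n ≤ ENNReal.ofReal t ∧ (ω n).2 ∈ O} =
      ∑' n, M.hitWeight O (ENNReal.ofReal t) n (0, s) := by
  have hA (n : ℕ) : MeasurableSet {ω : ℕ → ℝ≥0∞ × S |
      jumpTime ω n ≤ ENNReal.ofReal t ∧ (ω n).2 ∈ O} :=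
    (measurableSet_Iic.preimage (measurable_jumpTime n)).inter
      ((MeasurableSet.of_discrete (s := O)).preimage (by fun_prop))
  rw [Set.ofPred_exists, measure_iUnion₀ _ fun n => (hA n).nullMeasurableSet]
  · congr 1
    ext n
    rw [← add_zero n, ← lintegral_hitWeight, ← lintegral_indicator_one (hA _)]
    rfl
  · have key {m n : ℕ} (hmn : m < n) : AEDisjoint (M.pathLaw s)
        {ω | jumpTime ω m ≤ ENNReal.ofReal t ∧ (ω m).2 ∈ O}
        {ω | jumpTime ω n ≤ ENNReal.ofReal t ∧ (ω n).2 ∈ O} := by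
      rw [AEDisjoint, measure_eq_zero_iff_ae_notMem]
      filter_upwards [M.ae_absorbing s] with ω hω hmem
      have h1 : (ω (m + 1)).1 ≤ jumpTime ω n :=
        Finset.single_le_sum (f := fun k => (ω k).1) (fun _ _ => zero_le) (by simp; omega)
      rw [hω m (hO _ hmem.1.2), top_le_iff] at h1
      have := h1 ▸ hmem.2.1
      exact ENNReal.ofReal_ne_top (top_le_iff.1 this)
    intro m n hmn
    rcases lt_or_gt_of_ne hmn with h | h
    exacts [key h, (key h).symm]

lemma lintegral_step (M : JumpSystem S E) {s : S} (hs : M.totalRate s ≠ 0)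
    {f : ℝ≥0∞ × S → ℝ≥0∞} (hf : Measurable f) :
    ∫⁻ y, f y ∂M.step s = ∑ e, ∫⁻ r in Ioi (0 : ℝ),
      ENNReal.ofReal (M.rate s e * Real.exp (-(M.totalRate s * r))) *
        f (ENNReal.ofReal r, M.next s e) := by
  change ∫⁻ y, f y ∂(M.holdingLaw s).prod (M.jumpLaw s) = _
  rw [lintegral_prod_symm _ hf.aemeasurable, jumpLaw, if_neg hs, lintegral_finsetSum_measure]
  refine Finset.sum_congr rfl fun e _ => ?_
  have hm : Measurable fun r => f (r, M.next s e) := by fun_prop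
  have hg : Measurable (gammaPDF 1 (M.totalRate s)) := (measurable_gammaPDFReal 1 _).ennreal_ofReal
  rw [lintegral_smul_measure, lintegral_dirac' _ (Measurable.of_discrete), holdingLaw, if_neg hs,
    lintegral_map hm (by fun_prop), expMeasure, gammaMeasure,
    lintegral_withDensity_eq_lintegral_mul _ hg (by fun_prop), ENNReal.smul_def, smul_eq_mul,
    ← lintegral_const_mul _ (hg.mul (by fun_prop)), ← lintegral_indicator measurableSet_Ioi]
  refine lintegral_congr_ae ?_
  -- The exponential density does not vanish at 0, which the open half-line leaves out.
  have h0 : ∀ᵐ r : ℝ, r ≠ 0 := by simp [ae_iff, measure_singleton]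
  filter_upwards [h0] with r hr
  have hq : (M.totalRate s : ℝ) ≠ 0 := by exact_mod_cast hs
  change _ * (exponentialPDF _ r * _) = _
  rw [exponentialPDF_eq]
  by_cases h : 0 < r
  · rw [if_pos h.le, indicator_of_mem (mem_Ioi.2 h), ← mul_assoc]
    congr 1
    rw [← ENNReal.ofReal_coe_nnreal, ← ENNReal.ofReal_mul (by positivity)]
    congr 1
    push_cast
    field_simp
  · rw [if_neg fun h' => h (lt_of_le_of_ne h' hr.symm), indicator_of_notMem (by simpa using h)]
    simp

lemma hitWeight_succ [Countable S] (M : JumpSystem S E) {O : Set S} (s : S) (t : ℝ)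
    (k : ℕ) : M.hitWeight O (ENNReal.ofReal t) (k + 1) (0, s) =
      ∑ e, ∫⁻ r in Ioc 0 t, ENNReal.ofReal (M.rate s e * Real.exp (-(M.totalRate s * r))) *
        M.hitWeight O (ENNReal.ofReal (t - r)) k (0, M.next s e) := by
  simp only [hitWeight, zero_add]
  by_cases hs : M.totalRate s = 0
  · have hr (e : E) : M.rate s e = 0 := by
      have := Finset.sum_eq_zero_iff.1 (hs : ∑ e, M.rate s e = 0)
      exact this e (Finset.mem_univ e)
    simp only [hr, NNReal.coe_zero, zero_mul, ENNReal.ofReal_zero, lintegral_zero,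
      Finset.sum_const_zero]
    change ∫⁻ y, M.hitWeight O (ENNReal.ofReal t) k y ∂(M.holdingLaw s).prod (M.jumpLaw s) = 0
    rw [lintegral_prod _ (M.measurable_hitWeight _ _ _).aemeasurable, holdingLaw, if_pos hs,
      lintegral_dirac]
    simp [hitWeight_of_lt M O (ENNReal.ofReal_lt_top (r := t))]
  · change ∫⁻ y, M.hitWeight O (ENNReal.ofReal t) k y ∂M.step s = _
    rw [M.lintegral_step hs (M.measurable_hitWeight _ _ _)]
    refine Finset.sum_congr rfl fun e _ => ?_
    rw [← lintegral_indicator measurableSet_Ioi, ← lintegral_indicator measurableSet_Ioc]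
    congr 1
    ext r
    by_cases h0 : 0 < r
    · rw [indicator_of_mem (mem_Ioi.2 h0)]
      by_cases h1 : r ≤ t
      · rw [indicator_of_mem (mem_Ioc.2 ⟨h0, h1⟩)]
        congr 1
        have := M.hitWeight_add O (ENNReal.ofReal (t - r)) (ENNReal.ofReal r)
          ENNReal.ofReal_ne_top k 0 (M.next s e)
        rwa [← ENNReal.ofReal_add h0.le (by linarith), add_zero, add_sub_cancel] at this
      · rw [indicator_of_notMem (fun h => h1 h.2), hitWeight_of_lt, mul_zero]
        exact (ENNReal.ofReal_lt_ofReal_iff h0).2 (not_le.1 h1)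
    · rw [indicator_of_notMem (by simpa using h0), indicator_of_notMem (fun h => h0 h.1)]

lemma hitProb_nonneg (M : JumpSystem S E) (O : Set S) (s : S) (t : ℝ) : 0 ≤ M.hitProb O s t :=
  measureReal_nonneg

lemma hitProb_le_one (M : JumpSystem S E) (O : Set S) (s : S) (t : ℝ) : M.hitProb O s t ≤ 1 :=
  measureReal_le_one

lemma monotone_hitProb (M : JumpSystem S E) (O : Set S) (s : S) : Monotone (M.hitProb O s) :=
  fun _ _ h => measureReal_mono fun _ ⟨n, h1, h2⟩ => ⟨n, h1.trans (ENNReal.ofReal_le_ofReal h), h2⟩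

/-- Negative times are truncated to 0 by `ENNReal.ofReal`; this extends continuity and signs from
the half-line to the whole line. -/
lemma hitProb_max_zero (M : JumpSystem S E) (O : Set S) (s : S) (t : ℝ) :
    M.hitProb O s (max t 0) = M.hitProb O s t := by
  rcases le_total t 0 with h | h
  · simp [hitProb, h, ENNReal.ofReal_of_nonpos h]
  · rw [max_eq_left h]

lemma ofReal_hitProb (M : JumpSystem S E) (O : Set S) (s : S) (t : ℝ) :
    ENNReal.ofReal (M.hitProb O s t) =
      M.pathLaw s {ω | ∃ n, jumpTime ω n ≤ ENNReal.ofReal t ∧ (ω n).2 ∈ O} :=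
  ofReal_measureReal

/-- Conditioning on the first jump. -/
lemma ofReal_hitProb_eq [Countable S] (M : JumpSystem S E) {O : Set S} (hO : M.Absorbing O)
    (s : S) (t : ℝ) : ENNReal.ofReal (M.hitProb O s t) =
      O.indicator 1 s + ∑ e, ∫⁻ r in Ioc 0 t, ENNReal.ofReal
        (M.rate s e * Real.exp (-(M.totalRate s * r)) * M.hitProb O (M.next s e) (t - r)) := by
  have hm (e : E) (k : ℕ) : Measurable fun r => M.hitWeight O (ENNReal.ofReal (t - r)) k
      (0, M.next s e) := by
    -- Monotonicity in the horizon gives measurability in the jump time without a joint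
    -- measurability argument.
    refine Antitone.measurable fun a b hab => ?_
    have hle {u v : ℝ≥0∞} (h : u ≤ v) (k : ℕ) : M.hitWeight O u k ≤ M.hitWeight O v k := by
      induction k with
      | zero => exact indicator_le_indicator_of_subset (fun _ hx => ⟨hx.1.trans h, hx.2⟩)
                  (fun _ => zero_le)
      | succ k ih => exact fun x => lintegral_mono fun y => ih _
    exact hle (ENNReal.ofReal_le_ofReal (by linarith)) k _
  rw [ofReal_hitProb, M.measure_hit_eq_tsum hO, tsum_eq_zero_add' ENNReal.summable]
  congr 1
  · classical
    simp only [hitWeight, indicator_apply]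
    exact if_congr (and_iff_right zero_le) rfl rfl
  · simp only [M.hitWeight_succ s t]
    rw [Summable.tsum_finsetSum fun _ _ => ENNReal.summable]
    refine Finset.sum_congr rfl fun e _ => ?_
    have hm' (k : ℕ) := hm e k
    rw [← lintegral_tsum fun k => by fun_prop]
    refine lintegral_congr fun r => ?_
    rw [ENNReal.tsum_mul_left, ENNReal.ofReal_mul (p := _ * _) (by positivity), ofReal_hitProb,
      M.measure_hit_eq_tsum hO]

lemma hitProb_eq [Countable S] (M : JumpSystem S E) {O : Set S} (hO : M.Absorbing O)
    (s : S) {t : ℝ} (ht : 0 ≤ t) : M.hitProb O s t =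
      O.indicator 1 s + ∑ e, ∫ r in (0 : ℝ)..t,
        M.rate s e * Real.exp (-(M.totalRate s * r)) * M.hitProb O (M.next s e) (t - r) := by
  have h := congrArg ENNReal.toReal (M.ofReal_hitProb_eq hO s t)
  have hfin := (M.ofReal_hitProb_eq hO s t).symm.trans_ne ENNReal.ofReal_ne_top
  rw [ENNReal.add_ne_top] at hfin
  rw [ENNReal.toReal_ofReal (M.hitProb_nonneg _ _ _), ENNReal.toReal_add hfin.1 hfin.2,
    ENNReal.toReal_sum (fun e he => (ENNReal.sum_ne_top.1 hfin.2) e he)] at h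
  rw [h]
  congr 1
  · by_cases hs : s ∈ O <;> simp [hs]
  · refine Finset.sum_congr rfl fun e _ => ?_
    rw [intervalIntegral.integral_of_le ht, integral_eq_lintegral_of_nonneg_ae]
    · exact ae_of_all _ fun r => mul_nonneg (by positivity) (M.hitProb_nonneg _ _ _)
    · refine Measurable.aestronglyMeasurable (Measurable.mul (by fun_prop) ?_)
      exact (M.monotone_hitProb O _).measurable.comp (by fun_prop)

/-- The generator of the jump process. -/
noncomputable def gen (M : JumpSystem S E) (f : S → ℝ) (s : S) : ℝ :=
  ∑ e, M.rate s e * (f (M.next s e) - f s)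

/-- The substitution v = t - r frees the integrand of t, so that regularity in time is that of a
primitive. Monotonicity makes the integrand integrable, the primitive is then continuous, and by
continuity of the integrand it is differentiable. -/
lemma hitProb_eq_exp_mul [Countable S] (M : JumpSystem S E) {O : Set S} (hO : M.Absorbing O)
    (s : S) {t : ℝ} (ht : 0 ≤ t) : M.hitProb O s t =
      Real.exp (-(M.totalRate s * t)) * (O.indicator 1 s + ∫ v in (0 : ℝ)..t,
        ∑ e, Real.exp (M.totalRate s * v) * (M.rate s e * M.hitProb O (M.next s e) v)) := by
  have hint (e : E) : IntervalIntegrable (fun v => Real.exp (M.totalRate s * v) *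
      (M.rate s e * M.hitProb O (M.next s e) v)) volume 0 t := by
    refine (((M.monotone_hitProb O _).intervalIntegrable).const_mul _).continuousOn_mul ?_
    fun_prop
  rw [intervalIntegral.integral_finsetSum fun e _ => hint e, mul_add, M.hitProb_eq hO s ht,
    Finset.mul_sum]
  congr 1
  · by_cases hs : s ∈ O
    · simp [hO s hs]
    · simp [hs]
  · refine Finset.sum_congr rfl fun e _ => ?_
    rw [← intervalIntegral.integral_const_mul]
    have := intervalIntegral.integral_comp_sub_left (a := 0) (b := t) (fun v => M.rate s e *
      Real.exp (-(M.totalRate s * (t - v))) * M.hitProb O (M.next s e) v) t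
    simp only [sub_sub_cancel, sub_self, sub_zero] at this
    rw [this]
    refine intervalIntegral.integral_congr fun v _ => ?_
    have : Real.exp (-(M.totalRate s * (t - v))) =
        Real.exp (-(M.totalRate s * t)) * Real.exp (M.totalRate s * v) := by
      rw [← Real.exp_add]
      ring_nf
    simp only [this]
    ring

lemma continuous_hitProb [Countable S] (M : JumpSystem S E) {O : Set S} (hO : M.Absorbing O)
    (s : S) : Continuous (M.hitProb O s) := by
  have h : M.hitProb O s = (fun t => Real.exp (-(M.totalRate s * t)) * (O.indicator 1 s +
      ∫ v in (0 : ℝ)..t, ∑ e, Real.exp (M.totalRate s * v) *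
        (M.rate s e * M.hitProb O (M.next s e) v))) ∘ fun t => max t 0 := by
    ext t
    rw [← M.hitProb_max_zero, M.hitProb_eq_exp_mul hO s (le_max_right _ _)]
    rfl
  rw [h]
  refine Continuous.comp ?_ (by fun_prop)
  refine Continuous.mul (by fun_prop) (continuous_const.add ?_)
  refine intervalIntegral.continuous_primitive (fun a b => ?_) 0
  have (e : E) : IntervalIntegrable (fun v => Real.exp (M.totalRate s * v) *
      (M.rate s e * M.hitProb O (M.next s e) v)) volume a b :=
    (((M.monotone_hitProb O _).intervalIntegrable).const_mul _).continuousOn_mul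
      (by fun_prop)
  simpa [Finset.sum_fn] using IntervalIntegrable.sum Finset.univ fun e _ => this e

/-- The backward equation. -/
lemma hasDerivWithinAt_hitProb [Countable S] (M : JumpSystem S E) {O : Set S}
    (hO : M.Absorbing O) (s : S) {t : ℝ} (ht : 0 ≤ t) :
    HasDerivWithinAt (M.hitProb O s) (M.gen (fun s => M.hitProb O s t) s) (Ici 0) t := by
  have hc : Continuous fun v => ∑ e, Real.exp (M.totalRate s * v) *
      (M.rate s e * M.hitProb O (M.next s e) v) := by
    have := fun e => M.continuous_hitProb hO (M.next s e)
    fun_prop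
  have h1 := (hc.integral_hasStrictDerivAt 0 t).hasDerivAt.const_add (O.indicator 1 s : ℝ)
  have h2 : HasDerivAt (fun t => Real.exp (-(M.totalRate s * t)))
      (Real.exp (-(M.totalRate s * t)) * (-(M.totalRate s * 1))) t :=
    (((hasDerivAt_id t).const_mul _).neg).exp
  refine ((h2.mul h1).hasDerivWithinAt.congr_deriv ?_).congr
    (fun v hv => M.hitProb_eq_exp_mul hO s hv) (M.hitProb_eq_exp_mul hO s ht)
  have h3 := M.hitProb_eq_exp_mul hO s ht
  have hq : (M.totalRate s : ℝ) = ∑ e, (M.rate s e : ℝ) := by simp [totalRate]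
  simp only [gen, mul_sub, Finset.sum_sub_distrib, ← Finset.sum_mul, ← Finset.mul_sum, ← hq]
  rw [← mul_assoc (Real.exp _) (Real.exp _), ← Real.exp_add, neg_add_cancel, Real.exp_zero]
  rw [h3]
  simp only [← Finset.mul_sum]
  ring

lemma hitProb_zero [Countable S] (M : JumpSystem S E) {O : Set S} (hO : M.Absorbing O) (s : S) :
    M.hitProb O s 0 = O.indicator 1 s := by
  simp [M.hitProb_eq hO s le_rfl]

lemma passageCDF_eq_hitProb [Countable S] (M : JumpSystem S E) {d : S}
    (hd : M.totalRate d = 0) (s : S) : M.passageCDF s d = M.hitProb {d} s := by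
  ext t
  refine measureReal_congr ?_
  filter_upwards [M.ae_absorbing s] with ω hω
  refine propext (passageTime_le_iff (fun n hn => hω n ?_) t)
  rwa [mem_singleton_iff.1 hn]

lemma measureReal_passage_eq_hitProb [Countable S] (M : JumpSystem S E) {D O : Set S}
    (hD : M.Absorbing D) (hOD : O ⊆ D) (s : S) {t : ℝ} (ht : 0 ≤ t) :
    (M.pathLaw s).real {ω | ∃ x : ℝ≥0, passageTime ω D = x ∧ (x : ℝ) ≤ t ∧ IsIn ω x O} =
      M.hitProb O s t := by
  refine measureReal_congr ?_
  filter_upwards [M.ae_absorbing s] with ω hω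
  exact propext (exists_passageTime_iff hOD (fun n hn => hω n (hD _ hn)) ht)

end JumpSystem

namespace JumpSystem

/-! ### Uniqueness for the backward equation -/

variable {S E : Type} [Fintype E]

/-- A set of states that the process cannot leave. -/
def Invariant (M : JumpSystem S E) (P : Set S) : Prop :=
  ∀ s ∈ P, ∀ e, M.rate s e ≠ 0 → M.next s e ∈ P

/-- A Lyapunov function: its sublevel sets are finite and it grows at most exponentially in mean. It
excludes that the process explodes. -/
structure IsLyapunov (M : JumpSystem S E) (V : S → ℝ) (c : ℝ) : Prop where
  nonneg : ∀ s, 0 ≤ V s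
  finite : ∀ R, {s | V s ≤ R}.Finite
  const_nonneg : 0 ≤ c
  gen_le : ∀ s, M.gen V s ≤ c * V s

lemma gen_sub (M : JumpSystem S E) (f g : S → ℝ) (s : S) :
    M.gen (fun x => f x - g x) s = M.gen f s - M.gen g s := by
  simp only [gen, ← Finset.sum_sub_distrib]
  exact Finset.sum_congr rfl fun e _ => by ring

lemma gen_const_mul (M : JumpSystem S E) (a : ℝ) (f : S → ℝ) (s : S) :
    M.gen (fun x => a * f x) s = a * M.gen f s := by
  simp only [gen, Finset.mul_sum]
  exact Finset.sum_congr rfl fun e _ => by ring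

lemma gen_nonpos_of_isMax (M : JumpSystem S E) {P : Set S} (hP : M.Invariant P) {f : S → ℝ} {s : S}
    (hs : s ∈ P) (hf : ∀ x ∈ P, f x ≤ f s) : M.gen f s ≤ 0 := by
  refine Finset.sum_nonpos fun e _ => ?_
  by_cases he : M.rate s e = 0
  · simp [he]
  · exact mul_nonpos_of_nonneg_of_nonpos NNReal.zero_le_coe
      (sub_nonpos.2 (hf _ (hP s hs e he)))

/-- At a maximum point `t` over `[0, T]`, other than `0`, the derivative is nonnegative. -/
lemma deriv_nonneg_of_isMaxOn {φ : ℝ → ℝ} {φ' t T : ℝ} (h0 : 0 < t) (hT : t ≤ T)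
    (hd : HasDerivWithinAt φ φ' (Ici 0) t) (hmax : ∀ u ∈ Icc 0 T, φ u ≤ φ t) : 0 ≤ φ' := by
  have hd' : HasDerivWithinAt φ φ' (Icc 0 t) t := hd.mono Icc_subset_Ici_self
  have hm : IsLocalMaxOn φ (Icc 0 t) t :=
    IsMaxOn.localize fun u hu => hmax u ⟨hu.1, hu.2.trans hT⟩
  have hy : (0 : ℝ) - t ∈ posTangentConeAt (Icc 0 t) t := by
    refine sub_mem_posTangentConeAt_of_segment_subset ?_
    rw [segment_symm, segment_eq_Icc h0.le]
  have := hm.hasFDerivWithinAt_nonpos hd'.hasFDerivWithinAt hy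
  simp at this
  nlinarith

/-- The maximum principle for the backward equation. -/
theorem nonpos_of_backward (M : JumpSystem S E) {P : Set S} (hP : M.Invariant P) {V : S → ℝ} {c : ℝ}
    (hV : M.IsLyapunov V c) {D : S → ℝ → ℝ} {B : ℝ} (hB : ∀ s ∈ P, ∀ t, 0 ≤ t → D s t ≤ B)
    (hD : ∀ s ∈ P, ∀ t, 0 ≤ t →
      HasDerivWithinAt (D s) (M.gen (fun x => D x t) s) (Ici 0) t)
    (h0 : ∀ s ∈ P, D s 0 ≤ 0) {s : S} (hs : s ∈ P) {t : ℝ} (ht : 0 ≤ t) : D s t ≤ 0 := by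
  by_contra! hpos
  -- A discount rate strictly above the growth rate `c` of `V`.
  set l := c + 1 with hl
  have hc := hV.const_nonneg
  obtain ⟨ε, hε, hεs⟩ : ∃ ε > 0, ε * V s < Real.exp (-(l * t)) * D s t := by
    have h1 : 0 < Real.exp (-(l * t)) * D s t := by positivity
    refine ⟨Real.exp (-(l * t)) * D s t / (V s + 1), div_pos h1 (by linarith [hV.nonneg s]), ?_⟩
    rw [div_mul_eq_mul_div, div_lt_iff₀ (by linarith [hV.nonneg s])]
    nlinarith
  -- The penalty ε V makes this function negative outside a finite set of states, so it attains its
  -- maximum even though the state space is infinite; ε is small enough to keep it positive at the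
  -- given point.
  let Φ : S → ℝ → ℝ := fun x u => Real.exp (-(l * u)) * D x u - ε * V x
  have hΦc (x : S) (hx : x ∈ P) : ContinuousOn (Φ x) (Icc 0 t) := by
    have : ContinuousOn (D x) (Icc 0 t) := fun u hu =>
      ((hD x hx u hu.1).mono Icc_subset_Ici_self).continuousWithinAt
    fun_prop
  have hB' : 0 ≤ B := hpos.le.trans (hB s hs t ht)
  let Z : Set S := {x | x ∈ P ∧ V x ≤ B / ε}
  have hZ : Z.Finite := (hV.finite (B / ε)).subset fun x hx => hx.2
  have hout (x : S) (hx : x ∈ P) (hxZ : x ∉ Z) (u : ℝ) (hu : 0 ≤ u) : Φ x u < 0 := by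
    have h1 : B / ε < V x := not_le.1 fun h => hxZ ⟨hx, h⟩
    rw [div_lt_iff₀ hε] at h1
    have h2 : Real.exp (-(l * u)) ≤ 1 := Real.exp_le_one_iff.2 (by nlinarith)
    have h3 := hB x hx u hu
    have h4 := Real.exp_pos (-(l * u))
    have : Real.exp (-(l * u)) * D x u ≤ B := by nlinarith
    simp only [Φ]
    nlinarith
  have hsΦ : 0 < Φ s t := by simp only [Φ]; linarith
  have hsZ : s ∈ Z := by
    by_contra h
    exact absurd (hout s hs h t ht) (not_lt.2 hsΦ.le)
  have hmax (x : S) : ∃ u ∈ Icc 0 t, x ∈ Z → ∀ v ∈ Icc 0 t, Φ x v ≤ Φ x u := by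
    by_cases hx : x ∈ Z
    · obtain ⟨u, hu, h⟩ := isCompact_Icc.exists_isMaxOn (nonempty_Icc.2 ht) (hΦc x hx.1)
      exact ⟨u, hu, fun _ => h⟩
    · exact ⟨0, ⟨le_rfl, ht⟩, fun h => absurd h hx⟩
  choose τ hτ hτmax using hmax
  obtain ⟨y, hyZ, hy⟩ := Set.exists_max_image Z (fun x => Φ x (τ x)) hZ ⟨s, hsZ⟩
  set u := τ y with hu
  have hu0 : 0 ≤ u := (hτ y).1
  have hyΦ : 0 < Φ y u :=
    hsΦ.trans_le ((hτmax s hsZ t ⟨ht, le_rfl⟩).trans (hy s hsZ))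
  have hupos : 0 < u := by
    refine lt_of_le_of_ne hu0 fun h => ?_
    rw [← h] at hyΦ
    simp only [Φ, mul_zero, neg_zero, Real.exp_zero, one_mul] at hyΦ
    linarith [h0 y hyZ.1, mul_nonneg hε.le (hV.nonneg y)]
  have hd : HasDerivWithinAt (Φ y) (Real.exp (-(l * u)) * (-(l * 1)) * D y u +
      Real.exp (-(l * u)) * M.gen (fun x => D x u) y) (Ici 0) u :=
    ((((hasDerivAt_id u).const_mul l).neg.exp.hasDerivWithinAt).mul
      (hD y hyZ.1 u hu0)).sub_const _
  have h1 := deriv_nonneg_of_isMaxOn hupos (hτ y).2 hd (hτmax y hyZ)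
  have h2 : M.gen (fun x => Φ x u) y ≤ 0 := by
    refine M.gen_nonpos_of_isMax hP hyZ.1 fun x hx => ?_
    by_cases hxZ : x ∈ Z
    · exact (hτmax x hxZ u (hτ y)).trans (hy x hxZ)
    · exact (hout x hx hxZ u hu0).le.trans hyΦ.le
  simp only [Φ, gen_sub, gen_const_mul] at h2 hyΦ
  have h3 := mul_le_mul_of_nonneg_left (hV.gen_le y) hε.le
  have h4 := mul_nonneg hε.le (hV.nonneg y)
  have h5 : 0 < l := by linarith
  -- At the maximum, `h1`, `h2` and the bound on the generator of V give 0 ≤ -l e^{-lu} D + c ε V =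
  -- -l Φ - ε V, which is negative.
  nlinarith [mul_pos h5 hyΦ]

/-- Bounded solutions of the backward equation with the same initial values are equal. -/
theorem eq_of_backward (M : JumpSystem S E) {P : Set S} (hP : M.Invariant P) {V : S → ℝ} {c : ℝ}
    (hV : M.IsLyapunov V c) {F G : S → ℝ → ℝ} {B B' : ℝ} (hF : ∀ s ∈ P, ∀ t, 0 ≤ t → |F s t| ≤ B)
    (hG : ∀ s ∈ P, ∀ t, 0 ≤ t → |G s t| ≤ B')
    (hF' : ∀ s ∈ P, ∀ t, 0 ≤ t → HasDerivWithinAt (F s) (M.gen (fun x => F x t) s) (Ici 0) t)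
    (hG' : ∀ s ∈ P, ∀ t, 0 ≤ t → HasDerivWithinAt (G s) (M.gen (fun x => G x t) s) (Ici 0) t)
    (h0 : ∀ s ∈ P, F s 0 = G s 0) {s : S} (hs : s ∈ P) {t : ℝ} (ht : 0 ≤ t) :
    F s t = G s t := by
  refine le_antisymm (sub_nonpos.1 ?_) (sub_nonpos.1 ?_)
  · refine M.nonpos_of_backward hP hV (D := fun x u => F x u - G x u) (B := B + B')
      (fun x hx u hu => ?_) (fun x hx u hu => ?_) (fun x hx => (sub_eq_zero.2 (h0 x hx)).le) hs ht
    · linarith [abs_le.1 (hF x hx u hu), abs_le.1 (hG x hx u hu)]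
    · rw [gen_sub]
      exact (hF' x hx u hu).sub (hG' x hx u hu)
  · refine M.nonpos_of_backward hP hV (D := fun x u => G x u - F x u) (B := B + B')
      (fun x hx u hu => ?_) (fun x hx u hu => ?_)
      (fun x hx => (sub_eq_zero.2 (h0 x hx).symm).le) hs ht
    · linarith [abs_le.1 (hF x hx u hu), abs_le.1 (hG x hx u hu)]
    · rw [gen_sub]
      exact (hG' x hx u hu).sub (hF' x hx u hu)

end JumpSystem

/-! ### Calculus on the half-line -/

lemma hasDerivWithinAt_integral_Ici {g : ℝ → ℝ} (hg : ContinuousOn g (Ici 0)) {t : ℝ}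
    (ht : 0 ≤ t) : HasDerivWithinAt (fun t => ∫ u in (0 : ℝ)..t, g u) (g t) (Ici 0) t := by
  -- The extension of `g` by its value at 0 is continuous on the line and has the same integrals
  -- over [0, t].
  have hc : Continuous fun u => g (max u 0) :=
    hg.comp_continuous (by fun_prop) fun u => le_max_right u 0
  have h := (hc.integral_hasStrictDerivAt 0 t).hasDerivAt.hasDerivWithinAt (s := Ici 0)
  have heq (v : ℝ) (hv : v ∈ Ici (0 : ℝ)) :
      ∫ u in (0 : ℝ)..v, g u = ∫ u in (0 : ℝ)..v, g (max u 0) := by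
    refine intervalIntegral.integral_congr fun u hu => ?_
    rw [uIcc_of_le hv] at hu
    simp only [max_eq_left hu.1]
  simp only [max_eq_left ht] at h
  exact h.congr heq (heq t ht)

lemma integral_eq_sub_of_hasDerivWithinAt_Ici {φ ψ : ℝ → ℝ}
    (hφ : ∀ t, 0 ≤ t → HasDerivWithinAt φ (ψ t) (Ici 0) t) (hψ : ContinuousOn ψ (Ici 0)) {t : ℝ}
    (ht : 0 ≤ t) : ∫ u in (0 : ℝ)..t, ψ u = φ t - φ 0 := by
  refine intervalIntegral.integral_eq_sub_of_hasDeriv_right_of_le ht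
    (fun u hu => ((hφ u hu.1).mono Icc_subset_Ici_self).continuousWithinAt)
    (fun u hu => ((hφ u hu.1.le).hasDerivAt (Ici_mem_nhds hu.1)).hasDerivWithinAt) ?_
  exact (hψ.mono (by rw [uIcc_of_le ht]; exact Icc_subset_Ici_self)).intervalIntegrable

lemma eq_of_hasDerivWithinAt_Ici {φ : ℝ → ℝ} {a b t : ℝ} (ht : 0 ≤ t)
    (ha : HasDerivWithinAt φ a (Ici 0) t) (hb : HasDerivWithinAt φ b (Ici 0) t) : a = b :=
  (uniqueDiffOn_Ici 0 t ht).eq_deriv _ ha hb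

lemma eq_zero_of_linear_ode {φ : ℝ → ℝ} {r : ℝ}
    (hφ : ∀ t, 0 ≤ t → HasDerivWithinAt φ (-(r * φ t)) (Ici 0) t) (h0 : φ 0 = 0) {t : ℝ}
    (ht : 0 ≤ t) : φ t = 0 := by
  have h (u : ℝ) (hu : 0 ≤ u) :
      HasDerivWithinAt (fun u => Real.exp (r * u) * φ u) 0 (Ici 0) u := by
    refine ((((hasDerivAt_id u).const_mul r).exp.hasDerivWithinAt).mul (hφ u hu)).congr_deriv ?_
    simp only [id]
    ring
  have := integral_eq_sub_of_hasDerivWithinAt_Ici h continuousOn_const ht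
  simp only [intervalIntegral.integral_zero, h0, mul_zero, sub_zero] at this
  exact (mul_eq_zero.1 this.symm).resolve_left (Real.exp_pos _).ne'

/-- Any density of a passage time is almost everywhere the derivative of its distribution
function. -/
lemma IsPassageDensity.integral_mul_eq {f F g : ℝ → ℝ} (hf : IsPassageDensity f F)
    (hF : ∀ t, 0 ≤ t → HasDerivWithinAt F (g t) (Ici 0) t) (h : ℝ → ℝ) {t : ℝ} (ht : 0 ≤ t) :
    ∫ u in (0 : ℝ)..t, f u * h u = ∫ u in (0 : ℝ)..t, g u * h u := by
  refine intervalIntegral.integral_congr_ae ?_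
  -- By Lebesgue differentiation f = g almost everywhere, so nothing is required of `h`.
  filter_upwards [(hf.2 t ht).1.ae_hasDerivAt_integral] with x hx hxt
  rw [uIoc_of_le ht] at hxt
  rw [uIcc_of_le ht] at hx
  have h1 := (hx ⟨hxt.1.le, hxt.2⟩ 0 ⟨le_rfl, ht⟩).hasDerivWithinAt (s := Ici 0)
  have h2 := h1.congr (f₁ := F) (fun v hv => (hf.2 v hv).2) (hf.2 x hxt.1.le).2
  rw [eq_of_hasDerivWithinAt_Ici hxt.1.le h2 (hF x hxt.1.le)]

/-! ### Hitting rates and the product formula for independent components -/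

namespace JumpSystem

section

variable {S E : Type} [MeasurableSpace S] [DiscreteMeasurableSpace S] [Fintype E] [Countable S]

/-- The derivative of the hitting probability in time. -/
noncomputable def hitRate (M : JumpSystem S E) (O : Set S) (s : S) (t : ℝ) : ℝ :=
  M.gen (fun x => M.hitProb O x t) s

variable (M : JumpSystem S E) {O : Set S}

lemma hasDerivWithinAt_hitProb' (hO : M.Absorbing O) (s : S) {t : ℝ} (ht : 0 ≤ t) :
    HasDerivWithinAt (M.hitProb O s) (M.hitRate O s t) (Ici 0) t :=
  M.hasDerivWithinAt_hitProb hO s ht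

lemma continuous_hitRate (hO : M.Absorbing O) (s : S) : Continuous (M.hitRate O s) := by
  have := fun x => M.continuous_hitProb hO x
  unfold hitRate gen
  fun_prop

lemma hitRate_nonneg (hO : M.Absorbing O) (s : S) (t : ℝ) : 0 ≤ M.hitRate O s t := by
  have h (t : ℝ) (ht : 0 ≤ t) : 0 ≤ M.hitRate O s t := by
    rw [hitRate, ← (M.hasDerivWithinAt_hitProb hO s ht).derivWithin (uniqueDiffOn_Ici 0 t ht)]
    exact ((M.monotone_hitProb O s).monotoneOn _).derivWithin_nonneg
  have := h (max t 0) (le_max_right _ _)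
  simpa only [hitRate, hitProb_max_zero] using this

lemma integral_hitRate (hO : M.Absorbing O) (s : S) {t : ℝ} (ht : 0 ≤ t) :
    ∫ u in (0 : ℝ)..t, M.hitRate O s u = M.hitProb O s t - M.hitProb O s 0 :=
  integral_eq_sub_of_hasDerivWithinAt_Ici (fun _ hu => M.hasDerivWithinAt_hitProb hO s hu)
    (M.continuous_hitRate hO s).continuousOn ht

lemma isPassageDensity_hitRate (hO : M.Absorbing O) {s : S} (hs : s ∉ O) :
    IsPassageDensity (M.hitRate O s) (M.hitProb O s) := by
  refine ⟨M.hitRate_nonneg hO s, fun t ht =>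
    ⟨(M.continuous_hitRate hO s).intervalIntegrable _ _, ?_⟩⟩
  rw [M.integral_hitRate hO s ht, M.hitProb_zero hO, indicator_of_notMem hs, sub_zero]

lemma hitProb_of_mem (hO : M.Absorbing O) {s : S} (hs : s ∈ O) {t : ℝ} (ht : 0 ≤ t) :
    M.hitProb O s t = 1 := by
  refine le_antisymm (M.hitProb_le_one O s t) ?_
  have h := M.hitProb_zero hO s
  rw [indicator_of_mem hs] at h
  exact h.symm.le.trans (M.monotone_hitProb O s ht)

end

section

variable {S E : Type} [Fintype E]

lemma gen_of_totalRate_eq_zero (M : JumpSystem S E) {s : S} (hs : M.totalRate s = 0) (f : S → ℝ) :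
    M.gen f s = 0 := by
  have hr (e : E) : M.rate s e = 0 :=
    Finset.sum_eq_zero_iff.1 (hs : ∑ e, M.rate s e = 0) e (Finset.mem_univ e)
  simp [gen, hr]

/-- The generator acts as a derivation if every event changes at most one of two functions. -/
lemma gen_mul_of_split (M : JumpSystem S E) {f g : S → ℝ} {s : S}
    (h : ∀ e, M.rate s e ≠ 0 → f (M.next s e) = f s ∨ g (M.next s e) = g s) :
    M.gen (fun x => f x * g x) s = M.gen f s * g s + f s * M.gen g s := by
  simp only [gen, Finset.sum_mul, Finset.mul_sum, ← Finset.sum_add_distrib]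
  refine Finset.sum_congr rfl fun e _ => ?_
  by_cases he : M.rate s e = 0
  · simp [he]
  -- The product of the two increments, the obstruction to the Leibniz rule, vanishes.
  · rcases h e he with h | h <;> rw [h] <;> ring

lemma gen_add (M : JumpSystem S E) (f g : S → ℝ) (s : S) :
    M.gen (fun x => f x + g x) s = M.gen f s + M.gen g s := by
  simp only [gen, ← Finset.sum_add_distrib]
  exact Finset.sum_congr rfl fun e _ => by ring

end

/-- **Two independent components.** Suppose that two functions `F` and `W` of the state and the time
solve the backward equation, and that every event changes at most one of them. Then the probability
to be absorbed in `O` is the integral of `W` against the derivative of `F`, if it is so at time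
`0`. -/
theorem hitProb_eq_integral_mul {S E : Type} [MeasurableSpace S] [DiscreteMeasurableSpace S]
    [Fintype E] [Countable S] (M : JumpSystem S E) {O : Set S} (hO : M.Absorbing O)
    {P : Set S} (hP : M.Invariant P) {V : S → ℝ} {c : ℝ} (hV : M.IsLyapunov V c)
    {F f W : S → ℝ → ℝ}
    (hF : ∀ s ∈ P, ∀ t, 0 ≤ t → HasDerivWithinAt (F s) (f s t) (Ici 0) t)
    (hfc : ∀ s ∈ P, ContinuousOn (f s) (Ici 0))
    (hf : ∀ s ∈ P, ∀ t, 0 ≤ t → 0 ≤ f s t)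
    (hF1 : ∀ s ∈ P, ∀ t, 0 ≤ t → F s t ∈ Icc 0 1)
    (hWc : ∀ s ∈ P, ContinuousOn (W s) (Ici 0))
    (hW1 : ∀ s ∈ P, ∀ t, 0 ≤ t → |W s t| ≤ 1)
    (hFgen : ∀ s ∈ P, M.totalRate s ≠ 0 → ∀ t, 0 ≤ t → f s t = M.gen (fun x => F x t) s)
    (hWgen : ∀ s ∈ P, M.totalRate s ≠ 0 → ∀ t, 0 ≤ t →
      HasDerivWithinAt (W s) (M.gen (fun x => W x t) s) (Ici 0) t)
    (hsplit : ∀ s ∈ P, ∀ e, M.rate s e ≠ 0 → F (M.next s e) = F s ∨ W (M.next s e) = W s)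
    (habs : ∀ s ∈ P, M.totalRate s = 0 → ∀ t, 0 ≤ t → f s t * W s t = 0)
    (hF0 : ∀ s ∈ P, M.totalRate s ≠ 0 → F s 0 = 0)
    (h0 : ∀ s ∈ P, O.indicator 1 s = F s 0 * W s 0)
    {s : S} (hs : s ∈ P) {t : ℝ} (ht : 0 ≤ t) :
    M.hitProb O s t = F s 0 * W s 0 + ∫ u in (0 : ℝ)..t, f s u * W s u := by
  have hfW (s : S) (hs : s ∈ P) : ContinuousOn (fun u => f s u * W s u) (Ici 0) :=
    (hfc s hs).mul (hWc s hs)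
  have hint {g : ℝ → ℝ} (hg : ContinuousOn g (Ici 0)) {t : ℝ} (ht : 0 ≤ t) :
      IntervalIntegrable g volume 0 t :=
    (hg.mono (by rw [uIcc_of_le ht]; exact Icc_subset_Ici_self)).intervalIntegrable
  refine M.eq_of_backward hP hV (G := fun s t => F s 0 * W s 0 + ∫ u in (0 : ℝ)..t, f s u * W s u)
    (B := 1) (B' := 2) (fun x _ u _ => ?_) (fun x hx u hu => ?_)
    (fun x _ u hu => M.hasDerivWithinAt_hitProb hO x hu) (fun x hx u hu => ?_)
    (fun x hx => ?_) hs ht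
  · rw [abs_of_nonneg (M.hitProb_nonneg O x u)]
    exact M.hitProb_le_one O x u
  · have h1 : |F x 0 * W x 0| ≤ 1 := by
      rw [abs_mul]
      have := hF1 x hx 0 le_rfl
      rw [abs_of_nonneg this.1]
      exact mul_le_one₀ this.2 (abs_nonneg _) (hW1 x hx 0 le_rfl)
    have h2 : |∫ v in (0 : ℝ)..u, f x v * W x v| ≤ ∫ v in (0 : ℝ)..u, f x v := by
      refine (intervalIntegral.abs_integral_le_integral_abs hu).trans
        (intervalIntegral.integral_mono_on hu (hint (hfW x hx).abs hu) (hint (hfc x hx) hu) ?_)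
      intro v hv
      rw [abs_mul, abs_of_nonneg (hf x hx v hv.1)]
      exact mul_le_of_le_one_right (hf x hx v hv.1) (hW1 x hx v hv.1)
    -- The integral of f is F(u) - F(0) ≤ 1, whence the bound 2 on the candidate solution.
    rw [integral_eq_sub_of_hasDerivWithinAt_Ici (hF x hx) (hfc x hx) hu] at h2
    have h3 := hF1 x hx u hu
    have h4 := hF1 x hx 0 le_rfl
    exact (abs_add_le _ _).trans (by linarith [h3.2, h4.1])
  · refine ((hasDerivWithinAt_integral_Ici (hfW x hx) hu).const_add _).congr_deriv ?_
    by_cases hq : M.totalRate x = 0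
    · rw [habs x hx hq u hu, M.gen_of_totalRate_eq_zero hq]
    have hnext (e : E) (he : M.rate x e ≠ 0) := hP x hx e he
    have hfsplit (e : E) (he : M.rate x e ≠ 0) {v : ℝ} (hv : 0 ≤ v) :
        f (M.next x e) v = f x v ∨ W (M.next x e) v = W x v := by
      rcases hsplit x hx e he with h | h
      · exact Or.inl (eq_of_hasDerivWithinAt_Ici hv (hF _ (hnext e he) v hv)
          (h ▸ hF x hx v hv))
      · exact Or.inr (by rw [h])
    have hf' (v : ℝ) (hv : 0 ≤ v) :
        HasDerivWithinAt (f x) (M.gen (fun y => f y v) x) (Ici 0) v := by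
      refine HasDerivWithinAt.congr (f := fun v => M.gen (fun y => F y v) x) ?_
        (fun w hw => hFgen x hx hq w hw) (hFgen x hx hq v hv)
      refine HasDerivWithinAt.fun_sum fun e _ => ?_
      -- An event of rate zero may lead out of `P`, where nothing is known about `F`; it contributes
      -- nothing to the generator.
      by_cases he : M.rate x e = 0
      · simpa [he] using hasDerivWithinAt_const v (Ici (0 : ℝ)) (0 : ℝ)
      · exact ((hF _ (hnext e he) v hv).sub (hF x hx v hv)).const_mul _
    have hgc {g : S → ℝ → ℝ} (hg : ∀ s ∈ P, ContinuousOn (g s) (Ici 0)) :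
        ContinuousOn (fun v => M.gen (fun y => g y v) x) (Ici 0) := by
      refine continuousOn_finsetSum _ fun e _ => ?_
      by_cases he : M.rate x e = 0
      · simpa [he] using continuousOn_const
      · exact continuousOn_const.mul ((hg _ (hnext e he)).sub (hg x hx))
    have hprod (v : ℝ) (hv : 0 ≤ v) : HasDerivWithinAt (fun v => f x v * W x v)
        (M.gen (fun y => f y v * W y v) x) (Ici 0) v := by
      rw [M.gen_mul_of_split fun e he => hfsplit e he hv]
      exact (hf' v hv).mul (hWgen x hx hq v hv)
    have hFTC := integral_eq_sub_of_hasDerivWithinAt_Ici hprod (hgc hfW) hu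
    have hswap : M.gen (fun y => ∫ v in (0 : ℝ)..u, f y v * W y v) x =
        ∫ v in (0 : ℝ)..u, M.gen (fun y => f y v * W y v) x := by
      simp only [gen]
      rw [intervalIntegral.integral_finsetSum]
      · refine Finset.sum_congr rfl fun e _ => ?_
        by_cases he : M.rate x e = 0
        · simp [he]
        · rw [intervalIntegral.integral_const_mul, intervalIntegral.integral_sub
            (hint (hfW _ (hnext e he)) hu) (hint (hfW x hx) hu)]
      · intro e _
        by_cases he : M.rate x e = 0
        · simp [he]
        · exact ((hint (hfW _ (hnext e he)) hu).sub (hint (hfW x hx) hu)).const_mul _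
    -- The boundary term -f(0)W(0) of the time integral cancels against the generator of F(0)W(0),
    -- because F(0) = 0 before absorption. What remains is f(u)W(u).
    rw [gen_add, hswap, hFTC, M.gen_mul_of_split (f := fun y => F y 0) (g := fun y => W y 0),
      ← hFgen x hx hq 0 le_rfl, hF0 x hx hq]
    · ring
    · exact fun e he => (hsplit x hx e he).imp (fun h => by rw [h]) (fun h => by rw [h])
  · rw [M.hitProb_zero hO, h0 x hx]
    simp

/-- `U`, with derivative `u`, is a solution of the backward equation of the process in `P`, as long
as the process is not absorbed, and takes its values in `[0, 1]`. -/
structure IsComponent {S E : Type} [Fintype E] (M : JumpSystem S E) (P : Set S)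
    (U u : S → ℝ → ℝ) : Prop where
  hasDeriv : ∀ s ∈ P, ∀ t, 0 ≤ t → HasDerivWithinAt (U s) (u s t) (Ici 0) t
  continuous : ∀ s, Continuous (u s)
  nonneg : ∀ s t, 0 ≤ u s t
  mem_Icc : ∀ s t, U s t ∈ Icc (0 : ℝ) 1
  eq_gen : ∀ s ∈ P, M.totalRate s ≠ 0 → ∀ t, u s t = M.gen (fun x => U x t) s

lemma isComponent_one {S E : Type} [Fintype E] (M : JumpSystem S E) (P : Set S) :
    M.IsComponent P (fun _ _ => 1) (fun _ _ => 0) where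
  hasDeriv _ _ t _ := hasDerivWithinAt_const t _ _
  continuous _ := continuous_const
  nonneg _ _ := le_rfl
  mem_Icc _ _ := ⟨zero_le_one, le_rfl⟩
  eq_gen _ _ _ _ := by simp [gen]

/-- The hitting probabilities of an image process solve the backward equation. -/
lemma isComponent_hitProb {S E : Type} [Fintype E] (M : JumpSystem S E) {P : Set S}
    {S' E' : Type} [MeasurableSpace S'] [DiscreteMeasurableSpace S'] [Fintype E'] [Countable S']
    (M' : JumpSystem S' E') {O' : Set S'} (hO' : M'.Absorbing O') {π : S → S'}
    (hπ : ∀ s ∈ P, M.totalRate s ≠ 0 → ∀ φ : S' → ℝ,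
      M.gen (fun x => φ (π x)) s = M'.gen φ (π s)) :
    M.IsComponent P (fun s => M'.hitProb O' (π s)) (fun s => M'.hitRate O' (π s)) where
  hasDeriv s _ _ ht := M'.hasDerivWithinAt_hitProb hO' (π s) ht
  continuous s := M'.continuous_hitRate hO' (π s)
  nonneg s t := M'.hitRate_nonneg hO' (π s) t
  mem_Icc s t := ⟨M'.hitProb_nonneg O' (π s) t, M'.hitProb_le_one O' (π s) t⟩
  eq_gen s hs hq t := (hπ s hs hq fun y => M'.hitProb O' y t).symm

/-- The product formula with W = U - U', the form in which outcomes appear: the passage described by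
U has occurred and the later one described by U' has not. -/
theorem hitProb_eq_integral_mul_sub {S E : Type} [MeasurableSpace S] [DiscreteMeasurableSpace S]
    [Fintype E] [Countable S] (M : JumpSystem S E) {O : Set S} (hO : M.Absorbing O)
    {P : Set S} (hP : M.Invariant P) {V : S → ℝ} {c : ℝ} (hV : M.IsLyapunov V c)
    {F f U u U' u' : S → ℝ → ℝ} (hF : M.IsComponent P F f) (hU : M.IsComponent P U u)
    (hU' : M.IsComponent P U' u')
    (hsplit : ∀ s ∈ P, ∀ e, M.rate s e ≠ 0 → F (M.next s e) = F s ∨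
      U (M.next s e) = U s ∧ U' (M.next s e) = U' s)
    (habs : ∀ s ∈ P, M.totalRate s = 0 → ∀ t, 0 ≤ t → f s t = 0 ∨ U s t = U' s t)
    (hF0 : ∀ s ∈ P, M.totalRate s ≠ 0 → F s 0 = 0)
    (h0 : ∀ s ∈ P, O.indicator 1 s = F s 0 * (U s 0 - U' s 0))
    {s : S} (hs : s ∈ P) (hq : M.totalRate s ≠ 0) {t : ℝ} (ht : 0 ≤ t) :
    M.hitProb O s t = ∫ v in (0 : ℝ)..t, f s v * (U s v - U' s v) := by
  rw [M.hitProb_eq_integral_mul hO hP hV (F := F) (f := f) (W := fun s t => U s t - U' s t)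
    hF.hasDeriv (fun s _ => (hF.continuous s).continuousOn) (fun s _ t _ => hF.nonneg s t)
    (fun s _ t _ => hF.mem_Icc s t) ?_ ?_ (fun s hs hq t _ => hF.eq_gen s hs hq t) ?_ ?_ ?_
    hF0 h0 hs ht, hF0 s hs hq, zero_mul, zero_add]
  · exact fun s hs v hv => ((hU.hasDeriv s hs v hv).sub (hU'.hasDeriv s hs v hv)).continuousWithinAt
  · intro s _ t _
    have h1 := hU.mem_Icc s t
    have h2 := hU'.mem_Icc s t
    exact abs_le.2 ⟨by linarith [h1.1, h2.2], by linarith [h1.2, h2.1]⟩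
  · intro s hs hq t ht
    rw [gen_sub, ← hU.eq_gen s hs hq, ← hU'.eq_gen s hs hq]
    exact (hU.hasDeriv s hs t ht).sub (hU'.hasDeriv s hs t ht)
  · intro s hs e he
    refine (hsplit s hs e he).imp id fun h => ?_
    rw [h.1, h.2]
  · intro s hs hq t ht
    rcases habs s hs hq t ht with h | h <;> simp [h]

end JumpSystem

/-! ### The birth-death processes -/

lemma sum_queueEvent {A : Type*} [AddCommMonoid A] (g : QueueEvent → A) :
    ∑ e, g e = g .birth + g .death := by
  change (Multiset.map g (([.birth, .death] : List QueueEvent) : Multiset QueueEvent)).sum = _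
  simp

lemma sum_pairEvent {A : Type*} [AddCommMonoid A] (g : PairEvent → A) :
    ∑ e, g e = g .deathC + (g .birthG + g .deathG) := by
  change (Multiset.map g (([.deathC, .birthG, .deathG] : List PairEvent) : Multiset _)).sum = _
  simp

lemma sum_orderEvent {A : Type*} [AddCommMonoid A] (g : OrderEvent → A) :
    ∑ e, g e = g .bidLimit + (g .bidMarket + (g .bidCancel + (g .askLimit + (g .askMarket +
      (g .askCancelAhead + g .askCancelBehind))))) := by
  change (Multiset.map g (([.bidLimit, .bidMarket, .bidCancel, .askLimit, .askMarket,
    .askCancelAhead, .askCancelBehind] : List OrderEvent) : Multiset _)).sum = _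
  simp

lemma absorbing_birthDeathB (r : FlowRates) : (birthDeathB r).Absorbing {0} := by
  rintro _ rfl
  simp [JumpSystem.totalRate, birthDeathB]

lemma absorbing_pureDeathC (l : ℕ) (r : FlowRates) : (pureDeathC l r).Absorbing {0} := by
  rintro _ rfl
  simp [JumpSystem.totalRate, pureDeathC]

lemma absorbing_pairA (l : ℕ) (r : FlowRates) : (pairA l r).Absorbing {(0, 0)} := by
  rintro _ rfl
  simp [JumpSystem.totalRate, pairA, sum_pairEvent]

lemma gen_birthDeathB (r : FlowRates) (φ : ℕ → ℝ) {i : ℕ} (hi : i ≠ 0) :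
    (birthDeathB r).gen φ i =
      r.κ * (φ (i + 1) - φ i) + (r.μ + i * r.θ) * (φ (i - 1) - φ i) := by
  simp [JumpSystem.gen, sum_queueEvent, birthDeathB, hi]

lemma gen_pureDeathC (l : ℕ) (r : FlowRates) (φ : ℕ → ℝ) {i : ℕ} (hi : i ≠ 0) :
    (pureDeathC l r).gen φ i = (r.μ + (i - l : ℕ) * r.θ) * (φ (i - 1) - φ i) := by
  simp [JumpSystem.gen, pureDeathC, hi, -Nat.cast_tsub]

lemma gen_pureDeathC_zero (l : ℕ) (r : FlowRates) (φ : ℕ → ℝ) :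
    (pureDeathC l r).gen φ 0 = 0 := by
  simp [JumpSystem.gen, pureDeathC]

lemma gen_pairA_of_ne (l : ℕ) (r : FlowRates) (φ : ℕ × ℕ → ℝ) {c : ℕ} (hc : c ≠ 0) (g : ℕ) :
    (pairA l r).gen φ (c, g) = (r.μ + (c - l : ℕ) * r.θ) * (φ (c - 1, g) - φ (c, g)) +
      (r.κ * (φ (c, g + 1) - φ (c, g)) + g * r.θ * (φ (c, g - 1) - φ (c, g))) := by
  simp [JumpSystem.gen, sum_pairEvent, pairA, hc, -Nat.cast_tsub]

lemma gen_pairA_zero (l : ℕ) (r : FlowRates) (φ : ℕ × ℕ → ℝ) {g : ℕ} (hg : g ≠ 0) :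
    (pairA l r).gen φ (0, g) = r.κ * (φ (0, g + 1) - φ (0, g)) +
      (r.μ + g * r.θ) * (φ (0, g - 1) - φ (0, g)) := by
  simp [JumpSystem.gen, sum_pairEvent, pairA, hg]

/-! ### The pure death process -/

/-- The agent's next order is executed at rate `μ` once all orders before it are gone. -/
lemma hitRate_pureDeathC_succ (z : ℕ) (r : FlowRates) (i : ℕ) {t : ℝ} (ht : 0 ≤ t) :
    (pureDeathC (z + 1) r).hitRate {0} (i + 1) t = r.μ * ((pureDeathC z r).hitProb {0} i t -
      (pureDeathC (z + 1) r).hitProb {0} (i + 1) t) := by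
  have hO := absorbing_pureDeathC z r
  have hO' := absorbing_pureDeathC (z + 1) r
  induction i generalizing t with
  | zero =>
    rw [JumpSystem.hitRate, zero_add, gen_pureDeathC _ _ _ one_ne_zero, Nat.sub_self,
      JumpSystem.hitProb_of_mem _ hO rfl ht, JumpSystem.hitProb_of_mem _ hO' rfl ht]
    simp
  | succ i ih =>
    rw [← sub_eq_zero]
    -- State i + 2 of C^{z+1} and state i + 1 of C^z are left at this same rate; with the induction
    -- hypothesis, the defect of the identity decays at that rate, starting from 0.
    refine eq_zero_of_linear_ode (r := r.μ + (i + 1 - z : ℕ) * r.θ)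
      (φ := fun t => (pureDeathC (z + 1) r).hitRate {0} (i + 1 + 1) t -
        r.μ * ((pureDeathC z r).hitProb {0} (i + 1) t -
          (pureDeathC (z + 1) r).hitProb {0} (i + 1 + 1) t)) (fun u hu => ?_) ?_ ht
    · have hd (x : ℕ) := (pureDeathC (z + 1) r).hasDerivWithinAt_hitProb' hO' x hu
      have hd1 := (pureDeathC z r).hasDerivWithinAt_hitProb' hO (i + 1) hu
      have hrate (u : ℝ) : (pureDeathC (z + 1) r).hitRate {0} (i + 1 + 1) u =
          (r.μ + (i + 1 - z : ℕ) * r.θ) * ((pureDeathC (z + 1) r).hitProb {0} (i + 1) u -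
            (pureDeathC (z + 1) r).hitProb {0} (i + 1 + 1) u) := by
        rw [JumpSystem.hitRate, gen_pureDeathC _ _ _ (Nat.add_one_ne_zero _),
          Nat.add_sub_add_right, Nat.add_sub_cancel]
      have hrate1 : (pureDeathC z r).hitRate {0} (i + 1) u =
          (r.μ + (i + 1 - z : ℕ) * r.θ) * ((pureDeathC z r).hitProb {0} i u -
            (pureDeathC z r).hitProb {0} (i + 1) u) := by
        rw [JumpSystem.hitRate, gen_pureDeathC _ _ _ (Nat.add_one_ne_zero _), Nat.add_sub_cancel]
      have h := (((hd (i + 1)).sub (hd (i + 1 + 1))).const_mul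
        (r.μ + (i + 1 - z : ℕ) * r.θ : ℝ)).sub ((hd1.sub (hd (i + 1 + 1))).const_mul (r.μ : ℝ))
      refine (h.congr (fun v _ => ?_) ?_).congr_deriv ?_
      · simp only [hrate, Pi.sub_apply]
      · simp only [hrate, Pi.sub_apply]
      · rw [ih hu, hrate1, hrate u]
        ring
    · rw [JumpSystem.hitRate, gen_pureDeathC _ _ _ (Nat.succ_ne_zero _)]
      simp [JumpSystem.hitProb_zero _ hO, JumpSystem.hitProb_zero _ hO']

/-- By `hitRate_pureDeathC_succ` the difference d solves d' = f - μ d with d(0) = 0, where f is the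
hitting rate of C^z; the integrating factor e^{μt} gives the formula. -/
lemma hitProb_pureDeathC_sub_succ (z : ℕ) (r : FlowRates) {i : ℕ} (hi : i ≠ 0) {t : ℝ}
    (ht : 0 ≤ t) : (pureDeathC z r).hitProb {0} i t -
      (pureDeathC (z + 1) r).hitProb {0} (i + 1) t =
        Real.exp (-r.μ * t) * ∫ u in (0 : ℝ)..t,
          Real.exp (r.μ * u) * (pureDeathC z r).hitRate {0} i u := by
  have hO := absorbing_pureDeathC z r
  have hO' := absorbing_pureDeathC (z + 1) r
  have hc := (pureDeathC z r).continuous_hitRate hO i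
  rw [integral_eq_sub_of_hasDerivWithinAt_Ici (φ := fun t => Real.exp (r.μ * t) *
    ((pureDeathC z r).hitProb {0} i t - (pureDeathC (z + 1) r).hitProb {0} (i + 1) t))
    (fun u hu => ?_)
    (by fun_prop) ht]
  · rw [JumpSystem.hitProb_zero _ hO, JumpSystem.hitProb_zero _ hO', indicator_of_notMem (by simpa),
      indicator_of_notMem (by simp), sub_zero, mul_zero, sub_zero, ← mul_assoc, ← Real.exp_add]
    simp
  · refine ((((hasDerivAt_id u).const_mul (r.μ : ℝ)).exp.hasDerivWithinAt).mul
      (((pureDeathC z r).hasDerivWithinAt_hitProb' hO i hu).sub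
        ((pureDeathC (z + 1) r).hasDerivWithinAt_hitProb' hO' (i + 1) hu))).congr_deriv ?_
    rw [hitRate_pureDeathC_succ z r i hu]
    simp only [id, Pi.sub_apply]
    ring

/-! ### The race -/

instance : Countable Book :=
  Function.Injective.countable (f := fun x : Book => (x.bid, x.ahead, x.own, x.behind)) <| by
    rintro ⟨⟩ ⟨⟩ h
    simpa using h

section race

variable {rb ra : FlowRates}

lemma absorbing_raceOver : (race rb ra).Absorbing raceOver := by
  intro x hx
  simp [JumpSystem.totalRate, race, hx]

lemma totalRate_race_ne_zero {x : Book} (hx : x ∉ raceOver) :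
    (race rb ra).totalRate x ≠ 0 := by
  have h := rb.κ_pos
  simp [JumpSystem.totalRate, race, hx, sum_orderEvent, h.ne']

lemma totalRate_race_eq_zero_iff {x : Book} : (race rb ra).totalRate x = 0 ↔ x ∈ raceOver :=
  ⟨fun h => by_contra fun hx => totalRate_race_ne_zero hx h, fun h => absorbing_raceOver x h⟩

lemma gen_race {x : Book} (hx : x ∉ raceOver) (φ : Book → ℝ) : (race rb ra).gen φ x =
    rb.κ * (φ { x with bid := x.bid + 1 } - φ x) + (rb.μ * (φ { x with bid := x.bid - 1 } - φ x) +
    (x.bid * rb.θ * (φ { x with bid := x.bid - 1 } - φ x) +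
    (ra.κ * (φ { x with behind := x.behind + 1 } - φ x) +
    (ra.μ * (φ (if 0 < x.ahead then { x with ahead := x.ahead - 1 }
        else if 0 < x.own then { x with own := x.own - 1 }
        else { x with behind := x.behind - 1 }) - φ x) +
    (x.ahead * ra.θ * (φ { x with ahead := x.ahead - 1 } - φ x) +
    x.behind * ra.θ * (φ { x with behind := x.behind - 1 } - φ x)))))) := by
  simp [JumpSystem.gen, sum_orderEvent, race, hx]

/-- The total volume, plus one, is a Lyapunov function of the race. -/
lemma isLyapunov_race : (race rb ra).IsLyapunov
    (fun x => ((x.bid + x.ahead + x.own + x.behind + 1 : ℕ) : ℝ)) (rb.κ + ra.κ) where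
  nonneg _ := Nat.cast_nonneg _
  finite R := by
    refine (((Iic ⌊R⌋₊ ×ˢ Iic ⌊R⌋₊ ×ˢ Iic ⌊R⌋₊ ×ˢ Iic ⌊R⌋₊).toFinite).image
      fun p : ℕ × ℕ × ℕ × ℕ => Book.mk p.1 p.2.1 p.2.2.1 p.2.2.2).subset ?_
    rintro ⟨b, a, o, k⟩ h
    have : b + a + o + k + 1 ≤ ⌊R⌋₊ := Nat.le_floor h
    refine ⟨(b, a, o, k), ⟨?_, ?_, ?_, ?_⟩, rfl⟩ <;> simp only [mem_Iic] <;> omega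
  const_nonneg := by positivity
  gen_le x := by
    by_cases hx : x ∈ raceOver
    · rw [JumpSystem.gen_of_totalRate_eq_zero _ (absorbing_raceOver x hx)]
      positivity
    have hle {q : ℝ} {m n : ℕ} (hq : 0 ≤ q) (h : m ≤ n) : q * ((m : ℝ) - n) ≤ 0 :=
      mul_nonpos_of_nonneg_of_nonpos hq (sub_nonpos.2 (by exact_mod_cast h))
    have hone (q : ℝ) {m n : ℕ} (h : m = n + 1) : q * ((m : ℝ) - n) = q := by
      rw [h]
      push_cast
      ring
    let g : OrderEvent → ℝ := fun e => match e with
      | .bidLimit => rb.κ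
      | .askLimit => ra.κ
      | _ => 0
    have hg : ∑ e, g e = rb.κ + ra.κ := by simp [sum_orderEvent, g]
    calc _ ≤ ∑ e, g e := Finset.sum_le_sum fun e _ => ?_
      _ ≤ _ := by
        rw [hg]
        -- Only limit orders increase the volume, at constant rates. The added one keeps the
        -- Lyapunov function at least 1, so that it dominates this constant drift.
        exact le_mul_of_one_le_right (by positivity) (by exact_mod_cast Nat.le_add_left _ _)
    cases e
    case bidLimit =>
      rw [hone _ (by simp only [race]; omega)]
      simp [race, hx, g]
    case askLimit =>
      rw [hone _ (by simp only [race]; omega)]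
      simp [race, hx, g]
    all_goals
      refine hle NNReal.zero_le_coe ?_
      simp only [race]
      try split_ifs
      all_goals try simp only
      all_goals omega

/-- The reachable states of the race: orders ahead of the agent's protect them, and the two queues
are not depleted at the same time. -/
def raceStates (l : ℕ) : Set Book :=
  {x | x.own ≤ l ∧ (0 < x.ahead → x.own = l) ∧ ¬(x.bid = 0 ∧ x.ask = 0)}

lemma notMem_raceOver {x : Book} : x ∉ raceOver ↔ 0 < x.bid ∧ 0 < x.ahead + x.own + x.behind := by
  simp only [raceOver, Book.ask, mem_ofPred_eq]
  omega

lemma invariant_raceStates (l : ℕ) : (race rb ra).Invariant (raceStates l) := by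
  rintro ⟨b, a, o, k⟩ ⟨h1, h2, h3⟩ e he
  have hx : (⟨b, a, o, k⟩ : Book) ∉ raceOver := fun h => he (by simp [race, h])
  rw [notMem_raceOver] at hx
  simp only [Book.ask] at *
  cases e <;> simp only [race, raceStates, Book.ask, mem_ofPred_eq]
  case askMarket => split_ifs <;> simp only <;> omega
  all_goals omega

/-- The bid queue is a birth-death process. -/
lemma gen_race_bid {x : Book} (hx : x ∉ raceOver) (φ : ℕ → ℝ) :
    (race rb ra).gen (fun y => φ y.bid) x = (birthDeathB rb).gen φ x.bid := by
  have h := notMem_raceOver.1 hx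
  rw [gen_race hx, gen_birthDeathB _ _ h.1.ne']
  split_ifs <;> simp only <;> ring

/-- Without a limit order of the agent, the ask queue is a birth-death process. -/
lemma gen_race_ask {x : Book} (hx : x ∉ raceOver) (hP : x ∈ raceStates 0) (φ : ℕ → ℝ) :
    (race rb ra).gen (fun y => φ (y.ahead + y.behind)) x =
      (birthDeathB ra).gen φ (x.ahead + x.behind) := by
  have h := notMem_raceOver.1 hx
  obtain ⟨b, a, o, k⟩ := x
  obtain rfl : o = 0 := Nat.le_zero.1 hP.1
  have h5 : a + k ≠ 0 := by simp only at h; omega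
  rw [gen_race hx, gen_birthDeathB _ _ h5]
  rcases a with - | a <;> rcases k with - | k
  · exact absurd rfl h5
  all_goals
    simp only [← add_assoc, add_tsub_cancel_right, zero_add, add_zero, Nat.succ_pos, lt_irrefl,
      if_true, if_false, Nat.add_right_comm _ 1]
    push_cast
    ring

/-- The ask queue with the agent's limit order is the process `A`. -/
lemma gen_race_pairA {l : ℕ} {x : Book} (hx : x ∉ raceOver) (hP : x ∈ raceStates l)
    (φ : ℕ × ℕ → ℝ) : (race rb ra).gen (fun y => φ (y.ahead + y.own, y.behind)) x =
      (pairA l ra).gen φ (x.ahead + x.own, x.behind) := by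
  have h := notMem_raceOver.1 hx
  obtain ⟨b, a, o, k⟩ := x
  obtain ⟨h1, h2, -⟩ := hP
  simp only at h h1 h2
  rw [gen_race hx]
  rcases a with - | a
  · rcases o with - | o
    · simp only [add_zero]
      rw [gen_pairA_zero _ _ _ (by omega)]
      simp only [lt_irrefl, if_false]
      push_cast
      ring
    -- With nobody ahead, C is at most l and its cancellation rate is truncated to 0: the agent does
    -- not cancel.
    · rw [gen_pairA_of_ne _ _ _ (c := 0 + (o + 1)) (by omega),
        Nat.sub_eq_zero_of_le (show 0 + (o + 1) ≤ l by omega)]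
      simp only [lt_irrefl, if_false, Nat.succ_pos, if_true, zero_add, Nat.add_sub_cancel]
      push_cast
      ring
  · rw [gen_pairA_of_ne _ _ _ (c := a + 1 + o) (by omega), h2 (Nat.succ_pos _), Nat.add_sub_cancel,
      show a + 1 + l - 1 = a + l by omega]
    simp only [Nat.succ_pos, if_true, Nat.add_sub_cancel]
    push_cast
    ring

/-- The orders up to the agent's `z`-th unit order form the process `C`. -/
lemma gen_race_pureDeathC {l z : ℕ} (hz : z ≤ l) {x : Book} (hx : x ∉ raceOver)
    (hP : x ∈ raceStates l) (φ : ℕ → ℝ) :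
    (race rb ra).gen (fun y => φ (y.ahead + y.own - (l - z))) x =
      (pureDeathC z ra).gen φ (x.ahead + x.own - (l - z)) := by
  obtain ⟨b, a, o, k⟩ := x
  obtain ⟨h1, h2, -⟩ := hP
  simp only at h1 h2
  rw [gen_race hx]
  rcases a with - | a
  -- In this case the agent's `z`-th unit has been executed: the coordinate is 0 and stays there.
  · by_cases ho : o ≤ l - z
    · have h3 : 0 + o - (l - z) = 0 := by omega
      have h4 : 0 + (o - 1) - (l - z) = 0 := by omega
      simp only [h3, gen_pureDeathC_zero, lt_irrefl, if_false]
      split_ifs <;> simp only [h3, h4] <;> ring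
    · rw [gen_pureDeathC _ _ _ (i := 0 + o - (l - z)) (by omega),
        Nat.sub_eq_zero_of_le (show 0 + o - (l - z) ≤ z by omega)]
      simp only [lt_irrefl, if_false, show 0 < o by omega, if_true,
        show 0 + (o - 1) - (l - z) = 0 + o - (l - z) - 1 by omega]
      push_cast
      ring
  -- With orders ahead, the agent's order is still untouched. Exactly z of the counted units are the
  -- agent's, and the others, all ahead, can be cancelled.
  · obtain rfl := h2 (Nat.succ_pos _)
    rw [gen_pureDeathC _ _ _ (i := a + 1 + o - (o - z)) (by omega)]
    simp only [Nat.succ_pos, if_true, Nat.add_sub_cancel,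
      show a + 1 + o - (o - z) - z = a + 1 by omega,
      show a + 1 + o - (o - z) - 1 = a + o - (o - z) by omega]
    push_cast
    ring

end race

/-! ### Probabilities of the outcomes of the race -/

section outcome

variable {rb ra : FlowRates} {l : ℕ}

lemma hitProb_birthDeathB_zero (r : FlowRates) (i : ℕ) :
    (birthDeathB r).hitProb {0} i 0 = if i = 0 then 1 else 0 := by
  rw [JumpSystem.hitProb_zero _ (absorbing_birthDeathB r)]
  by_cases h : i = 0 <;> simp [h]

lemma hitProb_pureDeathC_zero (z : ℕ) (r : FlowRates) (i : ℕ) :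
    (pureDeathC z r).hitProb {0} i 0 = if i = 0 then 1 else 0 := by
  rw [JumpSystem.hitProb_zero _ (absorbing_pureDeathC z r)]
  by_cases h : i = 0 <;> simp [h]

lemma hitProb_pairA_zero (l : ℕ) (r : FlowRates) (c g : ℕ) :
    (pairA l r).hitProb {(0, 0)} (c, g) 0 = if c + g = 0 then 1 else 0 := by
  rw [JumpSystem.hitProb_zero _ (absorbing_pairA l r)]
  by_cases h : c + g = 0
  · obtain ⟨rfl, rfl⟩ := Nat.add_eq_zero_iff.1 h
    simp
  · have : (c, g) ≠ (0, 0) := fun h' => h (by simp_all)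
    rw [if_neg h, indicator_of_notMem (by simpa using this)]

lemma isComponent_bid (P : Set Book) : (race rb ra).IsComponent P
    (fun x => (birthDeathB rb).hitProb {0} x.bid) (fun x => (birthDeathB rb).hitRate {0} x.bid) :=
  JumpSystem.isComponent_hitProb _ _ (absorbing_birthDeathB rb) (π := Book.bid) fun _ _ hq φ =>
    gen_race_bid (mt totalRate_race_eq_zero_iff.2 hq) φ

lemma isComponent_ask : (race rb ra).IsComponent (raceStates 0)
    (fun x => (birthDeathB ra).hitProb {0} (x.ahead + x.behind))
    (fun x => (birthDeathB ra).hitRate {0} (x.ahead + x.behind)) :=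
  JumpSystem.isComponent_hitProb _ _ (absorbing_birthDeathB ra)
    (π := fun x : Book => x.ahead + x.behind) fun _ hx hq φ =>
      gen_race_ask (mt totalRate_race_eq_zero_iff.2 hq) hx φ

lemma isComponent_pairA : (race rb ra).IsComponent (raceStates l)
    (fun x => (pairA l ra).hitProb {(0, 0)} (x.ahead + x.own, x.behind))
    (fun x => (pairA l ra).hitRate {(0, 0)} (x.ahead + x.own, x.behind)) :=
  JumpSystem.isComponent_hitProb _ _ (absorbing_pairA l ra)
    (π := fun x : Book => (x.ahead + x.own, x.behind)) fun _ hx hq φ =>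
      gen_race_pairA (mt totalRate_race_eq_zero_iff.2 hq) hx φ

lemma isComponent_pureDeathC {z : ℕ} (hz : z ≤ l) : (race rb ra).IsComponent (raceStates l)
    (fun x => (pureDeathC z ra).hitProb {0} (x.ahead + x.own - (l - z)))
    (fun x => (pureDeathC z ra).hitRate {0} (x.ahead + x.own - (l - z))) :=
  JumpSystem.isComponent_hitProb _ _ (absorbing_pureDeathC z ra)
    (π := fun x : Book => x.ahead + x.own - (l - z)) fun _ hx hq φ =>
      gen_race_pureDeathC hz (mt totalRate_race_eq_zero_iff.2 hq) hx φ

/-- The independence of the two sides of the book enters here: a function that ignores the bid is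
changed only by ask events, and these leave the bid alone. -/
lemma race_next_split {A : Type*} {U : Book → A}
    (hU : ∀ x b, U ⟨b, x.ahead, x.own, x.behind⟩ = U x) (x : Book) (e : OrderEvent) :
    ((race rb ra).next x e).bid = x.bid ∨ U ((race rb ra).next x e) = U x := by
  cases e
  case askMarket =>
    left
    simp only [race]
    split_ifs <;> rfl
  case bidLimit => exact Or.inr (hU x _)
  case bidMarket => exact Or.inr (hU x _)
  case bidCancel => exact Or.inr (hU x _)
  all_goals exact Or.inl rfl

lemma birthDeathB_hitRate_zero (r : FlowRates) (t : ℝ) : (birthDeathB r).hitRate {0} 0 t = 0 :=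
  JumpSystem.gen_of_totalRate_eq_zero _ (absorbing_birthDeathB r 0 rfl) _

/-- The race ends with a depletion of the bid queue, in `O`. -/
lemma hitProb_race_of_bid {O : Set Book} (hO : ∀ x ∈ O, x.bid = 0) {U u U' u' : Book → ℝ → ℝ}
    (hU : (race rb ra).IsComponent (raceStates l) U u)
    (hU' : (race rb ra).IsComponent (raceStates l) U' u')
    (hUask : ∀ x b, U ⟨b, x.ahead, x.own, x.behind⟩ = U x)
    (hUask' : ∀ x b, U' ⟨b, x.ahead, x.own, x.behind⟩ = U' x)
    (hzero : ∀ x ∈ raceStates l, x.ask = 0 → ∀ t, 0 ≤ t → U x t = U' x t)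
    (h0 : ∀ x ∈ raceStates l, x.bid = 0 → O.indicator 1 x = U x 0 - U' x 0)
    {x : Book} (hx : x ∈ raceStates l) (hx' : x ∉ raceOver) {t : ℝ} (ht : 0 ≤ t) :
    (race rb ra).hitProb O x t =
      ∫ v in (0 : ℝ)..t, (birthDeathB rb).hitRate {0} x.bid v * (U x v - U' x v) := by
  have hOabs : (race rb ra).Absorbing O := fun y hy => absorbing_raceOver y (Or.inl (hO y hy))
  refine (race rb ra).hitProb_eq_integral_mul_sub hOabs (invariant_raceStates l) isLyapunov_race
    (isComponent_bid _) hU hU' (fun y _ e _ => ?_) (fun y hy hq v hv => ?_) (fun y _ hq => ?_)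
    (fun y hy => ?_) hx (totalRate_race_ne_zero hx') ht
  · have h := race_next_split (rb := rb) (ra := ra) (U := fun x => (U x, U' x))
      (fun x b => by rw [hUask, hUask']) y e
    refine h.imp (fun h => by rw [h]) fun h => ?_
    simpa using h
  -- Once the race is over the integrand must vanish: an empty bid has hitting rate 0, and on an
  -- empty ask the two ask functions agree.
  · rcases totalRate_race_eq_zero_iff.1 hq with h | h
    · left
      rw [h, birthDeathB_hitRate_zero]
    · exact Or.inr (hzero y hy h v hv)
  · have := notMem_raceOver.1 (mt totalRate_race_eq_zero_iff.2 hq)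
    rw [hitProb_birthDeathB_zero, if_neg this.1.ne']
  · rw [hitProb_birthDeathB_zero]
    by_cases hb : y.bid = 0
    · rw [if_pos hb, one_mul, h0 y hy hb]
    · rw [if_neg hb, zero_mul, indicator_of_notMem fun h => hb (hO y h)]

/-- The race ends with a depletion of the ask queue. -/
lemma hitProb_race_of_ask {O : Set Book} (hO : ∀ x ∈ O, x.ask = 0)
    (hO' : ∀ x ∈ raceStates l, x.ask = 0 → x ∈ O) {F f : Book → ℝ → ℝ}
    (hF : (race rb ra).IsComponent (raceStates l) F f)
    (hFask : ∀ x b, F ⟨b, x.ahead, x.own, x.behind⟩ = F x)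
    (hF0 : ∀ x ∈ raceStates l, F x 0 = if x.ask = 0 then 1 else 0)
    (hf0 : ∀ x ∈ raceStates l, x.ask = 0 → ∀ t, f x t = 0)
    {x : Book} (hx : x ∈ raceStates l) (hx' : x ∉ raceOver) {t : ℝ} (ht : 0 ≤ t) :
    (race rb ra).hitProb O x t =
      ∫ v in (0 : ℝ)..t, f x v * (1 - (birthDeathB rb).hitProb {0} x.bid v) := by
  have hOabs : (race rb ra).Absorbing O := fun y hy => absorbing_raceOver y (Or.inr (hO y hy))
  refine (race rb ra).hitProb_eq_integral_mul_sub hOabs (invariant_raceStates l) isLyapunov_race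
    hF ((race rb ra).isComponent_one _) (isComponent_bid _) (fun y _ e _ => ?_)
    (fun y hy hq v hv => ?_) (fun y hy hq => ?_)
    (fun y hy => ?_) hx (totalRate_race_ne_zero hx') ht
  · exact (race_next_split (rb := rb) (ra := ra) hFask y e).symm.imp id
      fun h => ⟨rfl, by rw [h]⟩
  · rcases totalRate_race_eq_zero_iff.1 hq with h | h
    · right
      rw [h, JumpSystem.hitProb_of_mem _ (absorbing_birthDeathB rb) rfl hv]
    · exact Or.inl (hf0 y hy h v)
  · have := notMem_raceOver.1 (mt totalRate_race_eq_zero_iff.2 hq)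
    rw [hF0 y hy, if_neg (show ¬y.ask = 0 from this.2.ne')]
  · rw [hF0 y hy, hitProb_birthDeathB_zero]
    by_cases ha : y.ask = 0
    · rw [if_pos ha, if_neg fun hb => hy.2.2 ⟨hb, ha⟩, indicator_of_mem (hO' y hy ha)]
      simp
    · rw [if_neg ha, zero_mul, indicator_of_notMem fun h => ha (hO y h)]

lemma mem_raceOutcome_down {z : ℕ} {x : Book} :
    x ∈ raceOutcome l .down z ↔ l - x.own = z ∧ x.bid = 0 := Iff.rfl

lemma mem_raceOutcome_up {z : ℕ} {x : Book} :
    x ∈ raceOutcome l .up z ↔ l - x.own = z ∧ x.ask = 0 := Iff.rfl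

lemma raceOutcome_subset (l : ℕ) (j' : PriceMove) (z : ℕ) : raceOutcome l j' z ⊆ raceOver := by
  rintro x ⟨-, h⟩
  cases j'
  · exact Or.inl h
  · exact Or.inr h

/-- An unreachable outcome has probability `0`. -/
lemma hitProb_race_eq_zero {O : Set Book} (hO : O ⊆ raceOver) (hO' : ∀ x ∈ raceStates l, x ∉ O)
    {x : Book} (hx : x ∈ raceStates l) {t : ℝ} (ht : 0 ≤ t) : (race rb ra).hitProb O x t = 0 := by
  have hOabs : (race rb ra).Absorbing O := fun y hy => absorbing_raceOver y (hO hy)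
  refine (race rb ra).eq_of_backward (invariant_raceStates l) isLyapunov_race
    (G := fun _ _ => 0) (B := 1) (B' := 0) (fun y _ u _ => ?_) (fun _ _ _ _ => by simp)
    (fun y _ u hu => JumpSystem.hasDerivWithinAt_hitProb _ hOabs y hu) (fun y _ u _ => ?_)
    (fun y hy => ?_) hx ht
  · rw [abs_of_nonneg (JumpSystem.hitProb_nonneg _ O y u)]
    exact JumpSystem.hitProb_le_one _ O y u
  · simpa [JumpSystem.gen] using hasDerivWithinAt_const u (Ici (0 : ℝ)) (0 : ℝ)
  · rw [JumpSystem.hitProb_zero _ hOabs, indicator_of_notMem (hO' y hy)]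

variable {x : Book} {t : ℝ}

/-- An empty ask leaves no unit of the agent outstanding, so only z = l is possible. The race then
asks for A to reach the origin before the bid queue empties. -/
lemma hitProb_race_up (hx : x ∈ raceStates l) (hx' : x ∉ raceOver) (ht : 0 ≤ t)
    (z : ℕ) : (race rb ra).hitProb (raceOutcome l .up z) x t =
    if z = l then ∫ v in (0 : ℝ)..t, (pairA l ra).hitRate {(0, 0)} (x.ahead + x.own, x.behind) v *
      (1 - (birthDeathB rb).hitProb {0} x.bid v) else 0 := by
  split_ifs with hz
  · subst hz
    refine hitProb_race_of_ask (fun y hy => hy.2) (fun y _ h => mem_raceOutcome_up.2 ⟨?_, h⟩)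
      isComponent_pairA (fun _ _ => rfl) (fun y _ => ?_) (fun y _ h t => ?_) hx hx' ht
    · have : y.own = 0 := by simp only [Book.ask] at h; omega
      rw [this, Nat.sub_zero]
    · rw [hitProb_pairA_zero]
      rfl
    · refine JumpSystem.gen_of_totalRate_eq_zero _ (absorbing_pairA z ra _ ?_) _
      simp only [Book.ask] at h
      simp only [mem_singleton_iff, Prod.mk.injEq]
      omega
  · refine hitProb_race_eq_zero (raceOutcome_subset _ _ _) (fun y hy h => hz ?_) hx ht
    have h1 := h.1
    have h2 : y.ask = 0 := h.2
    simp only [Book.ask] at h2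
    omega

lemma hitProb_race_down_zero (hx : x ∈ raceStates l) (hx' : x ∉ raceOver) (ht : 0 ≤ t)
    (hl : 1 ≤ l) : (race rb ra).hitProb (raceOutcome l .down 0) x t =
    ∫ v in (0 : ℝ)..t, (birthDeathB rb).hitRate {0} x.bid v *
      (1 - (pureDeathC 1 ra).hitProb {0} (x.ahead + x.own - (l - 1)) v) := by
  refine hitProb_race_of_bid (fun y hy => hy.2) (JumpSystem.isComponent_one _ _)
    (isComponent_pureDeathC hl) (fun _ _ => rfl) (fun _ _ => rfl) (fun y hy h t ht => ?_)
    (fun y hy h => ?_) hx hx' ht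
  · rw [JumpSystem.hitProb_of_mem _ (absorbing_pureDeathC 1 ra) _ ht]
    simp only [Book.ask] at h
    simp only [mem_singleton_iff]
    omega
  · obtain ⟨h1, h2, -⟩ := hy
    rw [hitProb_pureDeathC_zero]
    by_cases ho : y.own = l
    · rw [indicator_of_mem (mem_raceOutcome_down.2 ⟨by omega, h⟩), if_neg (by omega)]
      simp
    · rw [indicator_of_notMem fun hy => ho (by have := hy.1; omega), if_pos (by omega), sub_self]

/-- Exactly z units are executed when C^z has reached 0 and C^{z+1} has not, that is, when the
agent's outstanding volume is l - z. -/
lemma hitProb_race_down_of_lt (hx : x ∈ raceStates l) (hx' : x ∉ raceOver) (ht : 0 ≤ t)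
    {z : ℕ} (hz : 1 ≤ z) (hzl : z < l) :
    (race rb ra).hitProb (raceOutcome l .down z) x t =
    ∫ v in (0 : ℝ)..t, (birthDeathB rb).hitRate {0} x.bid v *
      ((pureDeathC z ra).hitProb {0} (x.ahead + x.own - (l - z)) v -
        (pureDeathC (z + 1) ra).hitProb {0} (x.ahead + x.own - (l - (z + 1))) v) := by
  refine hitProb_race_of_bid (fun y hy => hy.2) (isComponent_pureDeathC hzl.le)
    (isComponent_pureDeathC hzl) (fun _ _ => rfl) (fun _ _ => rfl) (fun y hy h t ht => ?_)
    (fun y hy h => ?_) hx hx' ht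
  · simp only [Book.ask] at h
    rw [JumpSystem.hitProb_of_mem _ (absorbing_pureDeathC z ra) _ ht,
      JumpSystem.hitProb_of_mem _ (absorbing_pureDeathC (z + 1) ra) _ ht] <;>
    · simp only [mem_singleton_iff]
      omega
  · obtain ⟨h1, h2, -⟩ := hy
    rw [hitProb_pureDeathC_zero, hitProb_pureDeathC_zero]
    by_cases ho : y.own = l - z
    · rw [indicator_of_mem (mem_raceOutcome_down.2 ⟨by omega, h⟩), if_pos (by omega),
        if_neg (by omega)]
      simp
    · rw [indicator_of_notMem fun hy => ho (by have := hy.1; omega)]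
      split_ifs <;> first | omega | simp

/-- There is no unit after the l-th; the competing passage is instead the depletion of the whole ask
queue, described by A. -/
lemma hitProb_race_down_self (hx : x ∈ raceStates l) (hx' : x ∉ raceOver) (ht : 0 ≤ t)
    (hl : 1 ≤ l) : (race rb ra).hitProb (raceOutcome l .down l) x t =
    ∫ v in (0 : ℝ)..t, (birthDeathB rb).hitRate {0} x.bid v *
      ((pureDeathC l ra).hitProb {0} (x.ahead + x.own) v -
        (pairA l ra).hitProb {(0, 0)} (x.ahead + x.own, x.behind) v) := by
  have hC := isComponent_pureDeathC (rb := rb) (ra := ra) (le_refl l)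
  simp only [Nat.sub_self, Nat.sub_zero] at hC
  refine hitProb_race_of_bid (fun y hy => hy.2) hC isComponent_pairA
    (fun _ _ => rfl) (fun _ _ => rfl) (fun y hy h t ht => ?_) (fun y hy h => ?_) hx hx' ht
  · simp only [Book.ask] at h
    rw [JumpSystem.hitProb_of_mem _ (absorbing_pureDeathC l ra) _ ht,
      JumpSystem.hitProb_of_mem _ (absorbing_pairA l ra) _ ht]
    · simp only [mem_singleton_iff, Prod.mk.injEq]
      omega
    · simp only [mem_singleton_iff]
      omega
  · obtain ⟨h1, h2, h3⟩ := hy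
    simp only [Book.ask] at h3
    rw [hitProb_pureDeathC_zero, hitProb_pairA_zero, if_neg fun h' => h3 ⟨h, h'⟩, sub_zero]
    by_cases ho : y.own = 0
    · rw [indicator_of_mem (mem_raceOutcome_down.2 ⟨by omega, h⟩), if_pos (by omega), Pi.one_apply]
    · rw [indicator_of_notMem fun hy => ho (by have := hy.1; omega), if_neg (by omega)]

lemma hitProb_race_down_of_gt (hx : x ∈ raceStates l) (ht : 0 ≤ t) {z : ℕ} (hz : l < z) :
    (race rb ra).hitProb (raceOutcome l .down z) x t = 0 :=
  hitProb_race_eq_zero (raceOutcome_subset _ _ _) (fun _ _ h => by have := h.1; omega) hx ht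

lemma hitProb_race_up_of_zero (hx : x ∈ raceStates 0) (hx' : x ∉ raceOver) (ht : 0 ≤ t)
    (z : ℕ) :
    (race rb ra).hitProb (raceOutcome 0 .up z) x t =
    if z = 0 then ∫ v in (0 : ℝ)..t, (birthDeathB ra).hitRate {0} (x.ahead + x.behind) v *
      (1 - (birthDeathB rb).hitProb {0} x.bid v) else 0 := by
  split_ifs with hz
  · subst hz
    refine hitProb_race_of_ask (fun y hy => hy.2)
      (fun y _ h => mem_raceOutcome_up.2 ⟨Nat.zero_sub _, h⟩)
      isComponent_ask (fun _ _ => rfl) (fun y hy => ?_) (fun y hy h t => ?_) hx hx' ht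
    · have h := hy.1
      simp only [hitProb_birthDeathB_zero, Book.ask, Nat.le_zero.1 h, add_zero]
    · simp only [Book.ask] at h
      rw [show y.ahead + y.behind = 0 by omega, birthDeathB_hitRate_zero]
  · refine hitProb_race_eq_zero (raceOutcome_subset _ _ _) (fun y hy h => hz ?_) hx ht
    have h1 := h.1
    omega

lemma hitProb_race_down_of_zero (hx : x ∈ raceStates 0) (hx' : x ∉ raceOver) (ht : 0 ≤ t)
    (z : ℕ) :
    (race rb ra).hitProb (raceOutcome 0 .down z) x t =
    if z = 0 then ∫ v in (0 : ℝ)..t, (birthDeathB rb).hitRate {0} x.bid v *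
      (1 - (birthDeathB ra).hitProb {0} (x.ahead + x.behind) v) else 0 := by
  split_ifs with hz
  · subst hz
    refine hitProb_race_of_bid (fun y hy => hy.2) (JumpSystem.isComponent_one _ _)
      isComponent_ask (fun _ _ => rfl) (fun _ _ => rfl) (fun y hy h t ht => ?_) (fun y hy h => ?_)
      hx hx' ht
    · rw [JumpSystem.hitProb_of_mem _ (absorbing_birthDeathB ra) _ ht]
      simp only [Book.ask] at h
      simp only [mem_singleton_iff]
      omega
    · obtain ⟨h1, -, h3⟩ := hy
      simp only [Book.ask] at h3
      rw [hitProb_birthDeathB_zero,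
        indicator_of_mem (mem_raceOutcome_down.2 ⟨Nat.zero_sub _, h⟩), if_neg (by omega),
        sub_zero, Pi.one_apply]
  · exact hitProb_race_eq_zero (raceOutcome_subset _ _ _) (fun y hy h => hz (by have := h.1; omega))
      hx ht

end outcome

/-! ### The given distribution functions and the formulas for the kernel -/

lemma cdfB_eq (v : ℕ) (r : FlowRates) : cdfB v r = (birthDeathB r).hitProb {0} v :=
  JumpSystem.passageCDF_eq_hitProb _ (absorbing_birthDeathB r 0 rfl) v

lemma cdfC_eq (v l : ℕ) (r : FlowRates) : cdfC v l r = (pureDeathC l r).hitProb {0} (l + v) :=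
  JumpSystem.passageCDF_eq_hitProb _ (absorbing_pureDeathC l r 0 rfl) (l + v)

lemma cdfA_eq (v l : ℕ) (r : FlowRates) :
    cdfA v l r = (pairA l r).hitProb {(0, 0)} (l + v, 0) :=
  JumpSystem.passageCDF_eq_hitProb _ (absorbing_pairA l r (0, 0) rfl) (l + v, 0)

lemma reducedKernel_eq (bid ask : PriceMove → FlowRates) (j : PriceMove) (vb va m l : ℕ) {t : ℝ}
    (ht : 0 ≤ t) (j' : PriceMove) (z : ℕ) : reducedKernel bid ask j vb va m l t j' z =
      (race (bid j) (ask j)).hitProb (raceOutcome l j' z) ⟨vb - m, va, l, 0⟩ t :=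
  JumpSystem.measureReal_passage_eq_hitProb _ absorbing_raceOver (raceOutcome_subset l j' z) _ ht

lemma integral_hitRate_mul_one_sub {S E : Type} [MeasurableSpace S] [DiscreteMeasurableSpace S]
    [Fintype E] [Countable S] (M : JumpSystem S E) {O : Set S} (hO : M.Absorbing O) {s : S}
    (hs : s ∉ O) {g : ℝ → ℝ} (hg : Continuous g) {t : ℝ} (ht : 0 ≤ t) :
    ∫ v in (0 : ℝ)..t, M.hitRate O s v * (1 - g v) =
      M.hitProb O s t - ∫ v in (0 : ℝ)..t, M.hitRate O s v * g v := by
  have hc := M.continuous_hitRate hO s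
  have hcg : Continuous fun v => M.hitRate O s v * g v := hc.mul hg
  simp only [mul_sub, mul_one]
  rw [intervalIntegral.integral_sub (hc.intervalIntegrable _ _)
    (hcg.intervalIntegrable _ _), M.integral_hitRate hO s ht, M.hitProb_zero hO,
    indicator_of_notMem hs, sub_zero]

lemma sum_Icc_sub_succ (g : ℕ → ℝ) {l : ℕ} (hl : 1 ≤ l) :
    ∑ z ∈ Finset.Icc 1 (l - 1), (g z - g (z + 1)) = g 1 - g l := by
  induction l, hl using Nat.le_induction with
  | base => simp
  | succ n hn ih =>
    obtain ⟨k, rfl⟩ : ∃ k, n = k + 1 := ⟨n - 1, by omega⟩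
    rw [Nat.add_sub_cancel] at ih ⊢
    rw [Finset.sum_Icc_succ_top (by omega), ih]
    ring

theorem mainTheorem2 (bid ask : PriceMove → FlowRates) (j : PriceMove) (vb va m l : ℕ)
    (hva : 1 ≤ va) (hm : m < vb) :
    let μ : ℝ := (ask j).μ
    let FBb : ℝ → ℝ := cdfB (vb - m) (bid j)
    let FBa : ℝ → ℝ := cdfB va (ask j)
    let FA : ℝ → ℝ := cdfA va l (ask j)
    let FC : ℕ → ℝ → ℝ := fun z => cdfC va z (ask j)
    let Q : ℝ → PriceMove → ℕ → ℝ := reducedKernel bid ask j vb va m l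
    -- the first-passage times have densities
    ((∃ f, IsPassageDensity f FBb) ∧ (∃ f, IsPassageDensity f FBa) ∧
      (∃ f, IsPassageDensity f FA) ∧ (∀ z, 1 ≤ z → ∃ f, IsPassageDensity f (FC z))) ∧
    -- and the kernel is given by them
    ∀ (fBb fBa fA : ℝ → ℝ) (fC : ℕ → ℝ → ℝ),
      IsPassageDensity fBb FBb → IsPassageDensity fBa FBa → IsPassageDensity fA FA →
      (∀ z, 1 ≤ z → IsPassageDensity (fC z) (FC z)) →
      ∀ t : ℝ, 0 ≤ t → ∀ z' : ℕ,
        -- [S1]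
        (1 ≤ l → Q t .up z' =
          if z' = l then FA t - ∫ u in (0 : ℝ)..t, fA u * FBb u else 0) ∧
        -- [S2+]
        (l = 0 → Q t .up z' =
          if z' = 0 then FBa t - ∫ u in (0 : ℝ)..t, fBa u * FBb u else 0) ∧
        -- [S2-]
        (l = 0 → Q t .down z' =
          if z' = 0 then FBb t - ∫ u in (0 : ℝ)..t, fBb u * FBa u else 0) ∧
        -- [S3]
        (1 ≤ l → z' = 0 → Q t .down z' =
          FBb t - ∫ u in (0 : ℝ)..t, fBb u * FC 1 u) ∧
        -- [S4]
        (l = 1 → z' = 1 → Q t .down z' =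
          ∫ u in (0 : ℝ)..t, fBb u * (FC 1 u - FA u)) ∧
        -- [S5]
        (1 < l → 1 ≤ z' → z' ≤ l - 1 → Q t .down z' =
          ∫ ε in (0 : ℝ)..t, (Real.exp (-μ * ε) * fBb ε) *
            ∫ u in (0 : ℝ)..ε, Real.exp (μ * u) * fC z' u) ∧
        -- [S6]
        (1 < l → z' = l → Q t .down z' =
          (∫ u in (0 : ℝ)..t, fBb u * (FC 1 u - FA u)) -
            ∑ z ∈ Finset.Icc 1 (l - 1),
              ∫ ε in (0 : ℝ)..t, (Real.exp (-μ * ε) * fBb ε) *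
                ∫ u in (0 : ℝ)..ε, Real.exp (μ * u) * fC z u) ∧
        -- otherwise
        (1 ≤ l → l < z' → Q t .down z' = 0) := by
  intro μ FBb FBa FA FC Q
  have hBb : FBb = (birthDeathB (bid j)).hitProb {0} (vb - m) := cdfB_eq _ _
  have hBa : FBa = (birthDeathB (ask j)).hitProb {0} va := cdfB_eq _ _
  have hA : FA = (pairA l (ask j)).hitProb {(0, 0)} (l + va, 0) := cdfA_eq _ _ _
  have hC (z : ℕ) : FC z = (pureDeathC z (ask j)).hitProb {0} (z + va) := cdfC_eq _ _ _
  have hOB := absorbing_birthDeathB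
  have hOA := absorbing_pairA l (ask j)
  have hOC (z : ℕ) := absorbing_pureDeathC z (ask j)
  have hvb : vb - m ∉ ({0} : Set ℕ) := by simp only [mem_singleton_iff]; omega
  have hva' : va ∉ ({0} : Set ℕ) := by simp only [mem_singleton_iff]; omega
  have hvA : (l + va, 0) ∉ ({(0, 0)} : Set (ℕ × ℕ)) := by
    simp only [mem_singleton_iff, Prod.mk.injEq]
    omega
  have hvC (z : ℕ) : z + va ∉ ({0} : Set ℕ) := by simp only [mem_singleton_iff]; omega
  refine ⟨⟨⟨_, hBb ▸ JumpSystem.isPassageDensity_hitRate _ (hOB _) hvb⟩,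
    ⟨_, hBa ▸ JumpSystem.isPassageDensity_hitRate _ (hOB _) hva'⟩,
    ⟨_, hA ▸ JumpSystem.isPassageDensity_hitRate _ hOA hvA⟩,
    fun z _ => ⟨_, hC z ▸ JumpSystem.isPassageDensity_hitRate _ (hOC z) (hvC z)⟩⟩, ?_⟩
  intro fBb fBa fA fC hfBb hfBa hfA hfC t ht z'
  have hQ (j' : PriceMove) (z : ℕ) : Q t j' z =
      (race (bid j) (ask j)).hitProb (raceOutcome l j' z) ⟨vb - m, va, l, 0⟩ t :=
    reducedKernel_eq bid ask j vb va m l ht j' z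
  have hx : (⟨vb - m, va, l, 0⟩ : Book) ∈ raceStates l :=
    ⟨le_rfl, fun _ => rfl, fun h => by have := h.1; simp only at this; omega⟩
  have hx' : (⟨vb - m, va, l, 0⟩ : Book) ∉ raceOver :=
    notMem_raceOver.2 ⟨by simp only; omega, by simp only; omega⟩
  have iBb (g : ℝ → ℝ) {u : ℝ} (hu : 0 ≤ u) : ∫ v in (0 : ℝ)..u, fBb v * g v =
      ∫ v in (0 : ℝ)..u, (birthDeathB (bid j)).hitRate {0} (vb - m) v * g v :=
    hfBb.integral_mul_eq
      (fun v hv => hBb ▸ JumpSystem.hasDerivWithinAt_hitProb' _ (hOB _) _ hv) g hu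
  have iBa (g : ℝ → ℝ) {u : ℝ} (hu : 0 ≤ u) : ∫ v in (0 : ℝ)..u, fBa v * g v =
      ∫ v in (0 : ℝ)..u, (birthDeathB (ask j)).hitRate {0} va v * g v :=
    hfBa.integral_mul_eq
      (fun v hv => hBa ▸ JumpSystem.hasDerivWithinAt_hitProb' _ (hOB _) _ hv) g hu
  have iA (g : ℝ → ℝ) {u : ℝ} (hu : 0 ≤ u) : ∫ v in (0 : ℝ)..u, fA v * g v =
      ∫ v in (0 : ℝ)..u, (pairA l (ask j)).hitRate {(0, 0)} (l + va, 0) v * g v :=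
    hfA.integral_mul_eq (fun v hv => hA ▸ JumpSystem.hasDerivWithinAt_hitProb' _ hOA _ hv) g hu
  have iC {z : ℕ} (hz : 1 ≤ z) (g : ℝ → ℝ) {u : ℝ} (hu : 0 ≤ u) :
      ∫ v in (0 : ℝ)..u, fC z v * g v =
      ∫ v in (0 : ℝ)..u, (pureDeathC z (ask j)).hitRate {0} (z + va) v * g v :=
    (hfC z hz).integral_mul_eq
      (fun v hv => hC z ▸ JumpSystem.hasDerivWithinAt_hitProb' _ (hOC z) _ hv) g hu
  have cBb : Continuous FBb := hBb ▸ JumpSystem.continuous_hitProb _ (hOB _) _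
  have cBa : Continuous FBa := hBa ▸ JumpSystem.continuous_hitProb _ (hOB _) _
  have cA : Continuous FA := hA ▸ JumpSystem.continuous_hitProb _ hOA _
  have cC (z : ℕ) : Continuous (FC z) := hC z ▸ JumpSystem.continuous_hitProb _ (hOC z) _
  have cf := (birthDeathB (bid j)).continuous_hitRate (hOB _) (vb - m)
  -- The coordinate that follows the agent's `z`-th unit starts at z + va, the starting point of
  -- C^z.
  have hidx {z : ℕ} (hz : z ≤ l) : va + l - (l - z) = z + va := by omega
  have hcond {z : ℕ} (hz : 1 ≤ z) :
      ∫ ε in (0 : ℝ)..t, (Real.exp (-μ * ε) * fBb ε) *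
        ∫ u in (0 : ℝ)..ε, Real.exp (μ * u) * fC z u =
      ∫ ε in (0 : ℝ)..t, (birthDeathB (bid j)).hitRate {0} (vb - m) ε *
        (FC z ε - FC (z + 1) ε) := by
    rw [← iBb _ ht]
    refine intervalIntegral.integral_congr fun ε hε => ?_
    rw [uIcc_of_le ht] at hε
    have h := hitProb_pureDeathC_sub_succ z (ask j) (hvC z) hε.1
    simp only [hC, show z + 1 + va = z + va + 1 by omega, h]
    simp only [mul_comm (Real.exp (μ * _)), iC hz _ hε.1]
    simp only [mul_comm (Real.exp _), μ]
    ring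
  have hself (hl : 1 ≤ l) : Q t .down l = ∫ v in (0 : ℝ)..t,
      (birthDeathB (bid j)).hitRate {0} (vb - m) v * (FC l v - FA v) := by
    rw [hQ, hitProb_race_down_self hx hx' ht hl, hC, hA, add_comm va l]
  refine ⟨fun hl => ?_, fun hl => ?_, fun hl => ?_, fun hl hz => ?_, fun hl hz => ?_,
    fun hl hz hzl => ?_, fun hl hz => ?_, fun hl hz => ?_⟩
  · rw [hQ, hitProb_race_up hx hx' ht]
    congr 1
    simp only [add_comm va l]
    rw [iA _ ht, ← hBb, integral_hitRate_mul_one_sub _ hOA hvA cBb ht, hA]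
  · subst hl
    rw [hQ, hitProb_race_up_of_zero hx hx' ht]
    congr 1
    simp only [add_zero]
    rw [iBa _ ht, ← hBb, integral_hitRate_mul_one_sub _ (hOB _) hva' cBb ht, hBa]
  · subst hl
    rw [hQ, hitProb_race_down_of_zero hx hx' ht]
    congr 1
    simp only [add_zero]
    rw [iBb _ ht, ← hBa, integral_hitRate_mul_one_sub _ (hOB _) hvb cBa ht, hBb]
  · subst hz
    rw [hQ, hitProb_race_down_zero hx hx' ht hl]
    simp only [hidx hl]
    rw [iBb _ ht, ← hC, integral_hitRate_mul_one_sub _ (hOB _) hvb (cC 1) ht, hBb]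
  · subst hz
    subst hl
    rw [hself le_rfl, iBb _ ht]
  · rw [hcond hz, hQ, hitProb_race_down_of_lt hx hx' ht hz (by omega)]
    simp only [hidx (show z' ≤ l by omega), hidx (show z' + 1 ≤ l by omega), hC]
  · subst hz
    -- By `hcond` the sum telescopes to the integral against F_{C^1} - F_{C^l}; subtracting it
    -- leaves F_{C^l} - F_{A^l}.
    rw [hself hl.le, Finset.sum_congr rfl fun z hz => hcond (Finset.mem_Icc.1 hz).1,
      ← intervalIntegral.integral_finsetSum, iBb _ ht, ← intervalIntegral.integral_sub]
    · refine intervalIntegral.integral_congr fun v _ => ?_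
      rw [← Finset.mul_sum, sum_Icc_sub_succ (fun z => FC z v) hl.le]
      ring
    · exact (cf.mul ((cC 1).sub cA)).intervalIntegrable _ _
    · exact (continuous_finsetSum _ fun z _ =>
        cf.mul ((cC z).sub (cC (z + 1)))).intervalIntegrable _ _
    · exact fun z _ => (cf.mul ((cC z).sub (cC (z + 1)))).intervalIntegrable _ _
  · rw [hQ, hitProb_race_down_of_gt hx ht hz]
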